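/- **Conventions.** $\mathbb N=\{1,2,\dots\}$; $[\mathbb N]^{<\omega}$ is the set of finite subsets of $\mathbb N$, whose members are identified with strictly increasing tuples of positive integers. For finite sets, $s<t$ means $x<y$ for all $x\in s$, $y\in t$. A family $\mathcal F\subseteq[\mathbb N]^{<\omega}$ is a *tree* if $\mathcal F^*=\mathcal F$, where $\mathcal F^*$ consists of $\emptyset$ and all initial segments of members of $\mathcal F$. For every countable limit ordinal $\lambda$ fix a strictly increasing sequence $(\lambda_n)_{n\ge1}$ of successor ordinals with $\lambda_n<\lambda$ and $\sup_n\lambda_n=\lambda$. The families $\mathcal A_\xi\subseteq[\mathbb N]^{<\omega}$, $\xi<\omega_1$, are defined recursively: 1. $\mathcal A_0=\{\emptyset\}$; 2. $\mathcal A_{\zeta+1}=\{\{n\}\cup s: n\in\mathbb N,\ \{n\}<s,\ s\in\mathcal A_\zeta\}$; 3. $\mathcal A_{\omega^{\beta+1}}=\{s_1\cup\dots\cup s_n: s_1<\dots<s_n,\ s_i\in\mathcal A_{\omega^\beta},\ n=\min s_1\}$; 4. $\mathcal A_{\omega^\lambda}=\{s\neq\emptyset: s\in\mathcal A_{\omega^{\lambda_n}}\text{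 with } n=\min s\}$ for limit $\lambda$; 5. if $\xi=\omega^{a_0}p_0+\omega^{a_1}p_1+\dots+\omega^{a_m}p_m$ with $a_0>a_1>\dots>a_m>0$, $p_i\in\mathbb N$, and $m\ge1$ or $p_0>1$, then $\mathcal A_\xi$ consists of the sets $s_0\cup s_1\cup\dots\cup s_m$ with $s_m<\dots<s_1<s_0$, where each $s_i$ is a union of $p_i$ sets $s^i_1<\dots<s^i_{p_i}$ in $\mathcal A_{\omega^{a_i}}$. Let $\varphi(s)=\sum_{\ell\in s}2^{\ell-1}$, a bijection from the nonempty finite subsets of $\mathbb N$ onto $\mathbb N$, and $c(n)=\min\varphi^{-1}(n)$. For $L\subseteq\mathbb N$ and $1\le\xi<\omega_1$ put $$P^\xi(L)=\Big\{\Big(\sum_{\ell\in s_1}\ell,\dots,\sum_{\ell\in s_k}\ell\Big): k\ge1,\ s_1<\dots<s_k\text{ nonempty finite subsets of }L,\ (c(\min s_1),\dots,c(\min s_k))\in\mathcal A_\xi\Big\},$$ $$P(L)=\Big\{\Big(\sum_{\ell\in s_1}\ell,\dots,\sum_{\ell\in s_k}\ell\Big): k\ge1,\ s_1<\dots<s_k\text{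 nonempty finite subsets of }L\Big\}.$$ **Corollary 3.6.** Let $\mathcal F\subseteq[\mathbb N]^{<\omega}$ be a tree. Call an infinite set $L\subseteq\mathbb N$ *admissible* if $\varphi^{-1}(\ell)<\varphi^{-1}(\ell')$ whenever $\ell<\ell'$ are in $L$. Then * either there is an admissible infinite $L\subseteq\mathbb N$ with $P(L)\subseteq\mathcal F$; * or there is a countable ordinal $\xi_0$ such that for every countable ordinal $\xi>\xi_0$ there is an admissible infinite $L\subseteq\mathbb N$ with $P^\xi(L)\subseteq[\mathbb N]^{<\omega}\setminus\mathcal F$. (The alternatives need not exclude each other. In particular, for admissible $L$ all tuples in $P(L)$ and $P^\xi(L)$ are strictly increasing.) -/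

import Mathlib

namespace BlockRamsey

open Ordinal

/-! Convention: the natural numbers of the theory are `1, 2, 3, …`; they are modelled by the
nonzero elements of `ℕ`. -/

/-- The family of all finite sets of positive integers. -/
def finSub : Set (Finset ℕ) := {s | ∀ n ∈ s, 1 ≤ n}

/-- `s < t` for finite sets: every element of `s` is smaller than every element of `t`.
For nonempty `s`, `t` this is `max s < min t`; it is vacuous if one of them is empty, and
nonemptiness is required separately wherever it matters. -/
def BlockLT (s t : Finset ℕ) : Prop := ∀ x ∈ s, ∀ y ∈ t, x < y

/-- `t` is an initial segment of `s` (possibly empty, possibly all of `s`). -/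
def IsInitialSegment (t s : Finset ℕ) : Prop := t ⊆ s ∧ ∀ x ∈ t, ∀ y ∈ s, y ≤ x → y ∈ t

/-- `F^*`: all initial segments of members of `F`, together with the empty set. -/
def initialSegments (F : Set (Finset ℕ)) : Set (Finset ℕ) :=
  {t | ∃ s ∈ F, IsInitialSegment t s} ∪ {∅}

/-- A family of finite sets is a tree if `F^* = F`. -/
def IsTree (F : Set (Finset ℕ)) : Prop := initialSegments F = F

/-- A choice, for every countable limit ordinal `l`, of a strictly increasing sequence
`lam l 1 < lam l 2 < ⋯` of successor ordinals smaller than `l` with supremum `l`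
(the values `lam l 0` are irrelevant). -/
def IsLimitChoice (lam : Ordinal.{0} → ℕ → Ordinal.{0}) : Prop :=
  ∀ l : Ordinal.{0}, Order.IsSuccLimit l → l < ω₁ →
    StrictMonoOn (lam l) (Set.Ici 1) ∧
    (∀ n : ℕ, 1 ≤ n → (∃ b : Ordinal.{0}, lam l n = b + 1) ∧ lam l n < l) ∧
    IsLUB (lam l '' Set.Ici 1) l

/-- `Schreier lam ξ s` says that `s` belongs to the family `A_ξ` of the recursive thin Schreier
system built from the choice `lam`. The five rules are the five clauses of the recursion; they
apply to disjoint classes of ordinals `ξ`, and each refers only to smaller ordinals. -/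
inductive Schreier (lam : Ordinal.{0} → ℕ → Ordinal.{0}) : Ordinal.{0} → Finset ℕ → Prop
  | zero : Schreier lam 0 ∅
  | succ (ζ : Ordinal.{0}) (n : ℕ) (s : Finset ℕ) (hn : 1 ≤ n) (hns : BlockLT {n} s)
      (hs : Schreier lam ζ s) : Schreier lam (ζ + 1) (insert n s)
  /-- `A_{ω^(β+1)}`: unions of `n` successive members of `A_{ω^β}`, where `n` is the minimum of
  the first one (equivalently of the union). -/
  | opow_succ (β : Ordinal.{0}) (n : ℕ) (t : Fin n → Finset ℕ)
      (ht : ∀ i, Schreier lam (ω ^ β) (t i))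
      (hlt : ∀ i j, i < j → BlockLT (t i) (t j))
      (hmin : IsLeast (↑(Finset.univ.biUnion t) : Set ℕ) n) :
      Schreier lam (ω ^ (β + 1)) (Finset.univ.biUnion t)
  /-- `A_{ω^l}` for a limit `l`: members of `A_{ω^(lam l n)}` with minimum `n`. -/
  | opow_limit (l : Ordinal.{0}) (hl : Order.IsSuccLimit l) (n : ℕ) (s : Finset ℕ)
      (hmin : IsLeast (↑s : Set ℕ) n) (hs : Schreier lam (ω ^ lam l n) s) :
      Schreier lam (ω ^ l) s
  /-- `ξ = ω^(a 0) * p 0 + ⋯ + ω^(a m) * p m` (Cantor normal form) with all exponents positive,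
  not a single power of `ω`: unions of `p i` successive members of `A_{ω^(a i)}` for every `i`,
  those for the smaller exponents coming first. -/
  | limit (m : ℕ) (a : Fin (m + 1) → Ordinal.{0}) (p : Fin (m + 1) → ℕ)
      (ha : StrictAnti a) (ha0 : ∀ i, 0 < a i) (hp : ∀ i, 1 ≤ p i) (hmp : 1 ≤ m ∨ 1 < p 0)
      (t : (i : Fin (m + 1)) → Fin (p i) → Finset ℕ)
      (ht : ∀ i j, Schreier lam (ω ^ a i) (t i j))
      (hlt : ∀ i j j', j < j' → BlockLT (t i j) (t i j'))
      (hlt' : ∀ i i', i < i' → ∀ j j', BlockLT (t i' j') (t i j)) :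
      Schreier lam (List.ofFn fun i => ω ^ a i * (p i : Ordinal.{0})).sum
        (Finset.univ.biUnion fun i => Finset.univ.biUnion (t i))

/-- The family `A_ξ`. -/
def schreierFamily (lam : Ordinal.{0} → ℕ → Ordinal.{0}) (ξ : Ordinal.{0}) : Set (Finset ℕ) :=
  {s | Schreier lam ξ s}

/-- `φ(s) = ∑_{l ∈ s} 2^(l-1)`, for finite nonempty sets `s` of positive integers. -/
def phi (s : Finset ℕ) : ℕ := ∑ l ∈ s, 2 ^ (l - 1)

/-- `φ⁻¹(n)`: the positions (counted from `1`) of the binary digits of `n` equal to `1`. -/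
def phiInv (n : ℕ) : Finset ℕ := n.bitIndices.toFinset.image (· + 1)

theorem phi_phiInv (n : ℕ) : phi (phiInv n) = n := by
  unfold phi phiInv
  rw [Finset.sum_image (by intro a _ b _ h; simpa using h)]
  simp only [Nat.add_sub_cancel]
  exact Finset.sum_toFinset_bitIndices_two_pow n

theorem phiInv_phi {s : Finset ℕ} (hs : s ∈ finSub) : phiInv (phi s) = s := by
  have h1 : phi s = ∑ i ∈ s.image (· - 1), 2 ^ i := by
    unfold phi
    rw [Finset.sum_image]
    intro a ha b hb h
    have := hs a ha
    have := hs b hb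
    simp only at h
    omega
  unfold phiInv
  rw [h1, Finset.toFinset_bitIndices_sum_two_pow, Finset.image_image]
  ext x
  simp only [Finset.mem_image, Function.comp]
  constructor
  · rintro ⟨a, ha, rfl⟩
    rwa [Nat.sub_add_cancel (hs a ha)]
  · intro hx
    exact ⟨x, hx, Nat.sub_add_cancel (hs x hx)⟩

/-- The minimum of a nonempty finite set of natural numbers. -/
noncomputable def minElt (s : Finset ℕ) : ℕ := sInf (↑s : Set ℕ)

/-- `c(n) = min φ⁻¹(n)`. -/
noncomputable def c (n : ℕ) : ℕ := minElt (phiInv n)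

/-- Finite sets of positive integers are identified with strictly increasing tuples: the set of
the increasing enumerations of the members of the family `G`. -/
def tuples (G : Set (Finset ℕ)) : Set (List ℕ) := {w | w.Pairwise (· < ·) ∧ w.toFinset ∈ G}

/-- `s_1 < ⋯ < s_k` are nonempty finite subsets of `L`, with `k ≥ 1`. -/
def IsBlockSeq (L : Set ℕ) (S : List (Finset ℕ)) : Prop :=
  S ≠ [] ∧ (∀ s ∈ S, s.Nonempty ∧ (↑s : Set ℕ) ⊆ L) ∧ S.Pairwise BlockLT

/-- The tuple `(∑_{l ∈ s_1} l, …, ∑_{l ∈ s_k} l)`. -/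
def sumTuple (S : List (Finset ℕ)) : List ℕ := S.map fun s => ∑ l ∈ s, l

/-- The `ξ`-sum set `P^ξ(L)`, for `ξ ≥ 1`. -/
def sumSet (lam : Ordinal.{0} → ℕ → Ordinal.{0}) (ξ : Ordinal.{0}) (L : Set ℕ) :
    Set (List ℕ) :=
  {w | ∃ S, IsBlockSeq L S ∧ (S.map fun s => c (minElt s)) ∈ tuples (schreierFamily lam ξ) ∧
    w = sumTuple S}

/-- The `k`-sum set `P^k(L)` for a positive integer `k`. -/
def finSumSet (k : ℕ) (L : Set ℕ) : Set (List ℕ) :=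
  {w | ∃ S, IsBlockSeq L S ∧ S.length = k ∧ w = sumTuple S}

/-- `P(L)`, the union of the `P^k(L)` over all positive integers `k`. -/
def allSums (L : Set ℕ) : Set (List ℕ) := ⋃ k ∈ Set.Ici 1, finSumSet k L

/-- `L` is an infinite set of positive integers of the form `φ(D)` with `D` an infinite disjoint
collection: `φ⁻¹(l) < φ⁻¹(l')` for all `l < l'` in `L`. -/
def IsSumBase (L : Set ℕ) : Prop :=
  L.Infinite ∧ (∀ l ∈ L, 1 ≤ l) ∧ ∀ l ∈ L, ∀ l' ∈ L, l < l' → BlockLT (phiInv l) (phiInv l')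

end BlockRamsey

/-! The proof plays the rank of a tree against the rank of the Schreier families. A Nash-Williams
dichotomy for block sums (`IsSumBase.avoids_or_bar`) refines any sum base so that a given set `G` of
tuples either contains no block sum tuple or is a bar: every way of extending the empty tuple runs
into `G`.

Take `G` to be the tuples outside `F`. If they are avoided, the first alternative holds. Otherwise,
well-founded induction along the bar produces a countable `ξ₀` that is not a rank of the tree of
block sums lying in `F` (`Bar.exists_not_hasRank`), and this persists under refinement. For `ξ >
ξ₀`, refine again, now for the `ξ`-sums that lie in `F`. If these are avoided, the second
alternative holds. A bar is impossible: `A_ξ` is thin, so a path through a `ξ`-sum can hit the bar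
only at that sum, and all `ξ`-sums lie in `F` (`Bar.mem_of_isThin`). But a tree containing a copy of
`A_ξ` on an infinite set has rank at least `ξ` (`schreierFamily_large`,
`IsSumBase.hasRank_of_sums_mem`).

For the dichotomy, fix an idempotent ultrafilter `U` concentrated on sums of arbitrarily large
elements of the base. Either the root is barred along a tree with `U`-large branching, or unbarred
nodes form such a tree (`exists_tree_avoids_or_bar`). The Galvin–Glazer construction then fits all
block sums of one new base into that tree (`IsSumBase.exists_follows`). -/

namespace BlockRamsey

open Ordinal

/-- Unions `s ∪ t` of successive members `s < t` of two families. -/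
def join (B C : Set (Finset ℕ)) : Set (Finset ℕ) :=
  {v | ∃ s ∈ B, ∃ t ∈ C, BlockLT s t ∧ v = s ∪ t}

/-- Unions of successive members of the families of a list. -/
def joinList (Bs : List (Set (Finset ℕ))) : Set (Finset ℕ) := Bs.foldr join {∅}

@[simp] theorem joinList_nil : joinList [] = {∅} := rfl

@[simp] theorem joinList_cons (B : Set (Finset ℕ)) (Bs : List (Set (Finset ℕ))) :
    joinList (B :: Bs) = join B (joinList Bs) := rfl

theorem mem_joinList_ofFn {k : ℕ} {B : Fin k → Set (Finset ℕ)} {s : Finset ℕ} :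
    s ∈ joinList (List.ofFn B) ↔ ∃ t : Fin k → Finset ℕ, (∀ i, t i ∈ B i) ∧
      (∀ i j, i < j → BlockLT (t i) (t j)) ∧ s = Finset.univ.biUnion t := by
  induction k generalizing s with
  | zero => simp
  | succ k ih =>
    rw [List.ofFn_succ, joinList_cons]
    constructor
    · rintro ⟨s, hs, _, hv, hst, rfl⟩
      obtain ⟨t, ht, hlt, rfl⟩ := ih.1 hv
      refine ⟨Fin.cons s t, ?_, ?_, ?_⟩
      · intro i
        cases i using Fin.cases with
        | zero => simpa using hs
        | succ i => simpa using ht i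
      · intro i j hij
        cases j using Fin.cases with
        | zero => exact absurd hij (Fin.not_lt_zero _)
        | succ j =>
          cases i using Fin.cases with
          | zero =>
            intro x hx y hy
            exact hst x (by simpa using hx) y
              (Finset.mem_biUnion.2 ⟨j, Finset.mem_univ _, by simpa using hy⟩)
          | succ i => simpa using hlt i j (Fin.succ_lt_succ_iff.1 hij)
      · ext x
        simp [Fin.exists_fin_succ]
    · rintro ⟨t, ht, hlt, rfl⟩
      refine ⟨t 0, ht 0, Finset.univ.biUnion fun i : Fin k => t i.succ,
        ih.2 ⟨fun i => t i.succ, fun i => ht _, fun i j h => hlt _ _ (Fin.succ_lt_succ_iff.2 h),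
          rfl⟩, ?_, ?_⟩
      · intro x hx y hy
        obtain ⟨i, -, hi⟩ := Finset.mem_biUnion.1 hy
        exact hlt 0 i.succ (Fin.succ_pos i) x hx y hi
      · ext x
        simp [Fin.exists_fin_succ]

theorem mem_joinList_replicate {k : ℕ} {B : Set (Finset ℕ)} {s : Finset ℕ} :
    s ∈ joinList (List.replicate k B) ↔ ∃ t : Fin k → Finset ℕ, (∀ i, t i ∈ B) ∧
      (∀ i j, i < j → BlockLT (t i) (t j)) ∧ s = Finset.univ.biUnion t := by
  rw [← List.ofFn_const, mem_joinList_ofFn]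

/-- A Cantor normal form lists its exponents in decreasing order, while the blocks of the smaller
exponents come first in the sets; hence the reversal. -/
theorem mem_joinList_ofFn_reverse {k : ℕ} {B : Fin k → Set (Finset ℕ)} {s : Finset ℕ} :
    s ∈ joinList (List.ofFn B).reverse ↔ ∃ t : Fin k → Finset ℕ, (∀ i, t i ∈ B i) ∧
      (∀ i j, i < j → BlockLT (t j) (t i)) ∧ s = Finset.univ.biUnion t := by
  have : (List.ofFn B).reverse = List.ofFn fun i => B i.rev := by
    apply List.ext_getElem <;> simp [Fin.rev]
    intro i h
    congr 1
    ext
    simp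
    omega
  rw [this, mem_joinList_ofFn]
  constructor
  · rintro ⟨t, ht, hlt, rfl⟩
    refine ⟨fun i => t i.rev, fun i => by simpa using ht i.rev,
      fun i j h => hlt _ _ (Fin.rev_lt_rev.2 h), ?_⟩
    ext x
    simp only [Finset.mem_biUnion, Finset.mem_univ, true_and]
    exact Fin.revPerm.exists_congr_left
  · rintro ⟨t, ht, hlt, rfl⟩
    refine ⟨fun i => t i.rev, fun i => ht i.rev,
      fun i j h => hlt _ _ (Fin.rev_lt_rev.2 h), ?_⟩
    ext x
    simp only [Finset.mem_biUnion, Finset.mem_univ, true_and]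
    exact Fin.revPerm.exists_congr_left

/-! ### Cantor normal forms with positive exponents -/

/-- The ordinal `∑ ω ^ a * p` over the pairs `(a, p)` of a list. -/
noncomputable def cnfSum (l : List (Ordinal.{0} × ℕ)) : Ordinal.{0} :=
  (l.map fun x => ω ^ x.1 * (x.2 : Ordinal.{0})).sum

/-- Cantor normal forms with positive exponents that are not a single power of `ω`. -/
structure IsLimitCNF (l : List (Ordinal.{0} × ℕ)) : Prop where
  pairwise : l.Pairwise fun x y => y.1 < x.1
  pos : ∀ x ∈ l, 0 < x.1 ∧ 1 ≤ x.2
  ne_nil : l ≠ []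
  ne_single : ∀ b, l ≠ [(b, 1)]

theorem cnfSum_lt {l : List (Ordinal.{0} × ℕ)} (hl : l.Pairwise fun x y => y.1 < x.1)
    {b : Ordinal.{0}} (hb : ∀ x ∈ l, x.1 < b) : cnfSum l < ω ^ b := by
  induction l generalizing b with
  | nil => simpa [cnfSum] using opow_pos b omega0_pos
  | cons x l ih =>
    rw [List.pairwise_cons] at hl
    have h1 : cnfSum l < ω ^ x.1 := ih hl.2 hl.1
    have hx : x.1 < b := hb x (by simp)
    have h2 : cnfSum (x :: l) = ω ^ x.1 * x.2 + cnfSum l := by simp [cnfSum]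
    rw [h2]
    refine isPrincipal_add_omega0_opow b ?_ (h1.trans ((opow_lt_opow_iff_right one_lt_omega0).2 hx))
    calc ω ^ x.1 * (x.2 : Ordinal) < ω ^ x.1 * ω := by
          gcongr
          · exact opow_pos _ omega0_pos
          · exact natCast_lt_omega0 _
      _ = ω ^ (x.1 + 1) := (opow_add_one _ _).symm
      _ ≤ ω ^ b := opow_le_opow_right omega0_pos (Order.add_one_le_of_lt hx)

theorem CNF_cnfSum {l : List (Ordinal.{0} × ℕ)} (hl : l.Pairwise fun x y => y.1 < x.1)
    (hp : ∀ x ∈ l, 1 ≤ x.2) :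
    CNF ω (cnfSum l) = l.map fun x => (x.1, (x.2 : Ordinal.{0})) := by
  induction l with
  | nil => simp [cnfSum]
  | cons x l ih =>
    rw [List.pairwise_cons] at hl
    have h2 : cnfSum (x :: l) = ω ^ x.1 * x.2 + cnfSum l := by simp [cnfSum]
    have := hp x (by simp)
    rw [h2, CNF.opow_mul_add, ih hl.2 fun y hy => hp y (by simp [hy])]
    · simp
    · exact one_lt_omega0
    · exact_mod_cast (show x.2 ≠ 0 by omega)
    · exact natCast_lt_omega0 _
    · exact cnfSum_lt hl.2 hl.1

/-- `CNF ω` recovers the list from its sum. This uniqueness lets the general limit clause of the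
recursion be inverted and kept apart from the clauses for powers of `ω`. -/
theorem cnfSum_injective {l l' : List (Ordinal.{0} × ℕ)}
    (hl : l.Pairwise fun x y => y.1 < x.1) (hp : ∀ x ∈ l, 1 ≤ x.2)
    (hl' : l'.Pairwise fun x y => y.1 < x.1) (hp' : ∀ x ∈ l', 1 ≤ x.2)
    (h : cnfSum l = cnfSum l') : l = l' := by
  have h1 := CNF_cnfSum hl hp
  rw [h, CNF_cnfSum hl' hp'] at h1
  refine (List.map_injective_iff.2 ?_ h1).symm
  rintro ⟨a, p⟩ ⟨b, q⟩ hab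
  simpa using hab

/-- Divisibility by `ω` passes to the remainder modulo the leading power, so the exponent `0` never
occurs. -/
theorem exists_cnfSum_eq {ξ : Ordinal.{0}} (h : ω ∣ ξ) :
    ∃ l : List (Ordinal.{0} × ℕ), l.Pairwise (fun x y => y.1 < x.1) ∧
      (∀ x ∈ l, 0 < x.1 ∧ 1 ≤ x.2) ∧ cnfSum l = ξ := by
  -- The extra bound on the exponents keeps them strictly decreasing when the leading term is
  -- prepended.
  suffices H : ∃ l : List (Ordinal.{0} × ℕ), l.Pairwise (fun x y => y.1 < x.1) ∧
      (∀ x ∈ l, 0 < x.1 ∧ 1 ≤ x.2 ∧ x.1 ≤ log ω ξ) ∧ cnfSum l = ξ by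
    obtain ⟨l, h1, h2, h3⟩ := H
    exact ⟨l, h1, fun x hx => ⟨(h2 x hx).1, (h2 x hx).2.1⟩, h3⟩
  induction ξ using WellFoundedLT.induction with
  | _ ξ ih =>
  rcases eq_or_ne ξ 0 with rfl | h0
  · exact ⟨[], by simp [cnfSum]⟩
  have hle : ω ≤ ξ := le_of_dvd h0 h
  have hlog : 0 < log ω ξ := log_pos one_lt_omega0 h0 hle
  have hd : ω ∣ ω ^ log ω ξ := by
    simpa using opow_dvd_opow ω (Order.one_le_iff_pos.2 hlog)
  have hsum : ω ^ log ω ξ * (ξ / ω ^ log ω ξ) + ξ % ω ^ log ω ξ = ξ := div_add_mod _ _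
  have hr : ω ∣ ξ % ω ^ log ω ξ := by
    rw [← hsum] at h
    exact (dvd_add_iff (hd.trans (dvd_mul_right _ _))).1 h
  obtain ⟨l, h1, h2, h3⟩ := ih _ (mod_opow_log_lt_self ω h0) hr
  obtain ⟨p, hp⟩ := lt_omega0.1 (div_opow_log_lt ξ one_lt_omega0)
  have hp0 : 0 < ξ / ω ^ log ω ξ := div_opow_log_pos ω h0
  have hlt := log_mod_opow_log_lt_log_self one_lt_omega0 hle
  refine ⟨(log ω ξ, p) :: l, ?_, ?_, ?_⟩
  · exact List.pairwise_cons.2 ⟨fun x hx => (h2 x hx).2.2.trans_lt hlt, h1⟩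
  · intro x hx
    rcases List.mem_cons.1 hx with rfl | hx
    · refine ⟨hlog, ?_, le_rfl⟩
      rw [hp] at hp0
      exact_mod_cast hp0
    · exact ⟨(h2 x hx).1, (h2 x hx).2.1, (h2 x hx).2.2.trans hlt.le⟩
  · have : cnfSum ((log ω ξ, p) :: l) = ω ^ log ω ξ * p + cnfSum l := by simp [cnfSum]
    rw [this, ← hp, h3, hsum]

theorem IsLimitCNF.isSuccLimit {l : List (Ordinal.{0} × ℕ)} (hl : IsLimitCNF l) :
    Order.IsSuccLimit (cnfSum l) := by
  rw [isSuccLimit_iff, isSuccPrelimit_iff_omega0_dvd]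
  constructor
  · intro h
    exact hl.ne_nil (cnfSum_injective hl.pairwise (fun x hx => (hl.pos x hx).2) List.Pairwise.nil
      (by simp) (by simpa [cnfSum] using h))
  · have h := hl.pos
    -- Tails of the list need not satisfy `IsLimitCNF`; only positivity, which they inherit, is kept
    -- for the induction.
    generalize l = l at h
    induction l with
    | nil => simp [cnfSum]
    | cons x l ih =>
      have h2 : cnfSum (x :: l) = ω ^ x.1 * x.2 + cnfSum l := by simp [cnfSum]
      have hd : ω ∣ ω ^ x.1 := by
        simpa using opow_dvd_opow ω (Order.one_le_iff_pos.2 (h x (by simp)).1)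
      rw [h2]
      exact (dvd_add_iff (hd.trans (dvd_mul_right _ _))).2 (ih fun y hy => h y (by simp [hy]))

theorem IsLimitCNF.ne_opow {l : List (Ordinal.{0} × ℕ)} (hl : IsLimitCNF l) (b : Ordinal.{0}) :
    cnfSum l ≠ ω ^ b := fun h =>
  hl.ne_single b (cnfSum_injective hl.pairwise (fun x hx => (hl.pos x hx).2)
    (List.pairwise_singleton _ _) (by simp) (by simpa [cnfSum] using h))

theorem IsLimitCNF.opow_lt {l : List (Ordinal.{0} × ℕ)} (hl : IsLimitCNF l)
    {x : Ordinal.{0} × ℕ} (hx : x ∈ l) : ω ^ x.1 < cnfSum l := by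
  refine lt_of_le_of_ne ?_ (hl.ne_opow _).symm
  have h := hl.pos
  generalize l = l at h hx
  induction l with
  | nil => simp at hx
  | cons y l ih =>
    have h2 : cnfSum (y :: l) = ω ^ y.1 * y.2 + cnfSum l := by simp [cnfSum]
    rw [h2]
    rcases List.mem_cons.1 hx with rfl | hx
    · refine le_trans ?_ le_self_add
      have : (1 : Ordinal) ≤ x.2 := by exact_mod_cast (h x (by simp)).2
      simpa using mul_le_mul_right this (ω ^ x.1)
    · exact (ih (fun z hz => h z (by simp [hz])) hx).trans le_add_self

theorem exists_isLimitCNF {ξ : Ordinal.{0}} (h : Order.IsSuccLimit ξ) (hne : ∀ b : Ordinal.{0}, ξ ≠ ω ^ b) :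
    ∃ l, IsLimitCNF l ∧ cnfSum l = ξ := by
  rw [isSuccLimit_iff, isSuccPrelimit_iff_omega0_dvd] at h
  obtain ⟨l, h1, h2, h3⟩ := exists_cnfSum_eq h.2
  refine ⟨l, ⟨h1, h2, ?_, ?_⟩, h3⟩
  · rintro rfl
    exact h.1 (by simpa [cnfSum] using h3.symm)
  · rintro b rfl
    exact hne b (by simpa [cnfSum] using h3.symm)

end BlockRamsey

/-! ### Recursion formulas for the Schreier families -/

namespace BlockRamsey

open Ordinal

/-- The family of all singletons of positive integers. -/
def singletons : Set (Finset ℕ) := {s | ∃ n, 1 ≤ n ∧ s = {n}}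

/-- The families whose successive unions form the family of a limit Cantor normal form. -/
def cnfFamilies (lam : Ordinal.{0} → ℕ → Ordinal.{0}) (l : List (Ordinal.{0} × ℕ)) :
    List (Set (Finset ℕ)) :=
  (l.map fun x => joinList (List.replicate x.2 (schreierFamily lam (ω ^ x.1)))).reverse

/-- Inversion is recorded once with the index as an equation; each recursion formula below then
discards four cases by the shape of the ordinal. -/
theorem schreier_cases {lam : Ordinal.{0} → ℕ → Ordinal.{0}} {ξ : Ordinal.{0}} {s : Finset ℕ}
    (h : Schreier lam ξ s) :
    (ξ = 0 ∧ s = ∅) ∨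
    (∃ ζ, ξ = ζ + 1 ∧ s ∈ join singletons (schreierFamily lam ζ)) ∨
    (∃ β : Ordinal.{0}, ξ = ω ^ (β + 1) ∧ ∃ n, IsLeast (↑s : Set ℕ) n ∧
      s ∈ joinList (List.replicate n (schreierFamily lam (ω ^ β)))) ∨
    (∃ l : Ordinal.{0}, Order.IsSuccLimit l ∧ ξ = ω ^ l ∧ ∃ n, IsLeast (↑s : Set ℕ) n ∧
      s ∈ schreierFamily lam (ω ^ lam l n)) ∨
    (∃ l, IsLimitCNF l ∧ ξ = cnfSum l ∧ s ∈ joinList (cnfFamilies lam l)) := by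
  cases h with
  | zero => exact Or.inl ⟨rfl, rfl⟩
  | succ ζ n s hn hns hs =>
    exact Or.inr (Or.inl ⟨ζ, rfl, {n}, ⟨n, hn, rfl⟩, s, hs, hns, Finset.insert_eq n s⟩)
  | opow_succ β n t ht hlt hmin =>
    exact Or.inr (Or.inr (Or.inl ⟨β, rfl, n, hmin, mem_joinList_replicate.2 ⟨t, ht, hlt, rfl⟩⟩))
  | opow_limit l hl n s hmin hs =>
    exact Or.inr (Or.inr (Or.inr (Or.inl ⟨l, hl, rfl, n, hmin, hs⟩)))
  | limit m a p ha ha0 hp hmp t ht hlt hlt' =>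
    refine Or.inr (Or.inr (Or.inr (Or.inr ⟨List.ofFn fun i => (a i, p i), ⟨?_, ?_, ?_, ?_⟩,
      ?_, ?_⟩)))
    · rw [List.pairwise_ofFn]
      exact fun i j hij => ha hij
    · intro x hx
      obtain ⟨i, rfl⟩ := (List.mem_ofFn' _ _).1 hx
      exact ⟨ha0 i, hp i⟩
    · simp
    · intro b hb
      have hm : m = 0 := by simpa using congrArg List.length hb
      subst hm
      have : p 0 = 1 := by
        simp at hb
        exact hb.2
      omega
    · rw [cnfSum, List.map_ofFn]
      rfl
    · rw [cnfFamilies, List.map_ofFn, mem_joinList_ofFn_reverse]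
      refine ⟨fun i => Finset.univ.biUnion (t i), fun i =>
        mem_joinList_replicate.2 ⟨t i, ht i, hlt i, rfl⟩, ?_, rfl⟩
      intro i j hij x hx y hy
      obtain ⟨u, -, hu⟩ := Finset.mem_biUnion.1 hx
      obtain ⟨v, -, hv⟩ := Finset.mem_biUnion.1 hy
      exact hlt' i j hij v u x hu y hv

theorem schreierFamily_zero (lam : Ordinal.{0} → ℕ → Ordinal.{0}) :
    schreierFamily lam 0 = {∅} := by
  ext s
  constructor
  · intro h
    rcases schreier_cases h with ⟨-, h⟩ | ⟨ζ, h, -⟩ | ⟨β, h, -⟩ | ⟨l, -, h, -⟩ | ⟨l, hl, h, -⟩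
    · exact h
    · exact absurd h.symm (by simp)
    · exact absurd h.symm (opow_pos _ omega0_pos).ne'
    · exact absurd h.symm (opow_pos _ omega0_pos).ne'
    · exact absurd h.symm hl.isSuccLimit.bot_lt.ne'
  · rintro rfl
    exact Schreier.zero

theorem not_isSuccLimit_add_one (ζ : Ordinal.{0}) : ¬ Order.IsSuccLimit (ζ + 1) :=
  fun h => h.succ_ne ζ rfl

theorem isSuccLimit_omega0_opow {b : Ordinal.{0}} (hb : b ≠ 0) :
    Order.IsSuccLimit (ω ^ b) := isSuccLimit_opow_left isSuccLimit_omega0 hb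

theorem schreierFamily_add_one (lam : Ordinal.{0} → ℕ → Ordinal.{0}) (ζ : Ordinal.{0}) :
    schreierFamily lam (ζ + 1) = join singletons (schreierFamily lam ζ) := by
  ext s
  constructor
  · intro h
    rcases schreier_cases h with ⟨h, -⟩ | ⟨ζ', h, h'⟩ | ⟨β, h, -⟩ | ⟨l, hl, h, -⟩ | ⟨l, hl, h, -⟩
    · exact absurd h (by simp)
    · rwa [Order.add_one_inj.1 h]
    · exact absurd (h ▸ isSuccLimit_omega0_opow (by simp)) (not_isSuccLimit_add_one ζ)
    · exact absurd (h ▸ isSuccLimit_omega0_opow hl.bot_lt.ne') (not_isSuccLimit_add_one ζ)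
    · exact absurd (h ▸ hl.isSuccLimit) (not_isSuccLimit_add_one ζ)
  · rintro ⟨_, ⟨n, hn, rfl⟩, t, ht, hnt, rfl⟩
    exact Schreier.succ ζ n t hn hnt ht

theorem schreierFamily_opow_add_one (lam : Ordinal.{0} → ℕ → Ordinal.{0}) (β : Ordinal.{0}) :
    schreierFamily lam (ω ^ (β + 1)) = {s : Finset ℕ | ∃ n, IsLeast (↑s : Set ℕ) n ∧
      s ∈ joinList (List.replicate n (schreierFamily lam (ω ^ β)))} := by
  have hlim : Order.IsSuccLimit (ω ^ (β + 1)) := isSuccLimit_omega0_opow (by simp)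
  ext s
  constructor
  · intro h
    rcases schreier_cases h with ⟨h, -⟩ | ⟨ζ', h, -⟩ | ⟨β', h, h'⟩ | ⟨l, hl, h, -⟩ | ⟨l, hl, h, -⟩
    · exact absurd h hlim.bot_lt.ne'
    · exact absurd (h ▸ hlim) (not_isSuccLimit_add_one ζ')
    · rwa [Order.add_one_inj.1 ((opow_right_inj one_lt_omega0).1 h)]
    · exact absurd ((opow_right_inj one_lt_omega0).1 h ▸ hl) (not_isSuccLimit_add_one β)
    · exact absurd h.symm (hl.ne_opow _)
  · rintro ⟨n, hn, h⟩
    obtain ⟨t, ht, hlt, rfl⟩ := mem_joinList_replicate.1 h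
    exact Schreier.opow_succ β n t ht hlt hn

theorem schreierFamily_opow_limit (lam : Ordinal.{0} → ℕ → Ordinal.{0}) {l : Ordinal.{0}}
    (hl : Order.IsSuccLimit l) :
    schreierFamily lam (ω ^ l) = {s : Finset ℕ | ∃ n, IsLeast (↑s : Set ℕ) n ∧
      s ∈ schreierFamily lam (ω ^ lam l n)} := by
  have hlim : Order.IsSuccLimit (ω ^ l) := isSuccLimit_omega0_opow hl.bot_lt.ne'
  ext s
  constructor
  · intro h
    rcases schreier_cases h with ⟨h, -⟩ | ⟨ζ', h, -⟩ | ⟨β', h, -⟩ | ⟨l', -, h, h'⟩ | ⟨l, hl, h, -⟩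
    · exact absurd h hlim.bot_lt.ne'
    · exact absurd (h ▸ hlim) (not_isSuccLimit_add_one ζ')
    · exact absurd ((opow_right_inj one_lt_omega0).1 h ▸ hl) (not_isSuccLimit_add_one β')
    · rwa [(opow_right_inj one_lt_omega0).1 h]
    · exact absurd h.symm (hl.ne_opow _)
  · rintro ⟨n, hn, h⟩
    exact Schreier.opow_limit l hl n s hn h

theorem schreierFamily_cnfSum (lam : Ordinal.{0} → ℕ → Ordinal.{0})
    {l : List (Ordinal.{0} × ℕ)} (hl : IsLimitCNF l) :
    schreierFamily lam (cnfSum l) = joinList (cnfFamilies lam l) := by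
  have hlim := hl.isSuccLimit
  ext s
  constructor
  · intro h
    rcases schreier_cases h with ⟨h, -⟩ | ⟨ζ', h, -⟩ | ⟨β', h, -⟩ | ⟨l', -, h, -⟩ | ⟨l', hl', h, h'⟩
    · exact absurd h hlim.bot_lt.ne'
    · exact absurd (h ▸ hlim) (not_isSuccLimit_add_one ζ')
    · exact absurd h (hl.ne_opow _)
    · exact absurd h (hl.ne_opow _)
    · rwa [cnfSum_injective hl.pairwise (fun x hx => (hl.pos x hx).2) hl'.pairwise
        (fun x hx => (hl'.pos x hx).2) h]
  · intro h
    obtain ⟨m, hm⟩ : ∃ m, l.length = m + 1 :=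
      Nat.exists_eq_succ_of_ne_zero (by simpa using hl.ne_nil)
    obtain ⟨f, rfl⟩ : ∃ f : Fin (m + 1) → Ordinal.{0} × ℕ, l = List.ofFn f := by
      refine ⟨fun i => l.get (i.cast hm.symm), ?_⟩
      refine List.ext_getElem (by simp [hm]) fun i _ _ => ?_
      rw [List.getElem_ofFn]
      rfl
    rw [cnfFamilies, List.map_ofFn, mem_joinList_ofFn_reverse] at h
    obtain ⟨T, hT, hlt, rfl⟩ := h
    choose t ht hlt' hTt using fun i => mem_joinList_replicate.1 (hT i)
    obtain rfl : T = fun i => Finset.univ.biUnion (t i) := funext hTt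
    have hpos := fun i => hl.pos (f i) (List.mem_ofFn' _ _ |>.2 ⟨i, rfl⟩)
    have key := Schreier.limit (lam := lam) m (fun i => (f i).1) (fun i => (f i).2)
      (fun i j hij => List.pairwise_ofFn.1 hl.pairwise hij) (fun i => (hpos i).1)
      (fun i => (hpos i).2) ?_ t ht hlt' ?_
    · have he : cnfSum (List.ofFn f) =
          (List.ofFn fun i => ω ^ (f i).1 * ((f i).2 : Ordinal.{0})).sum := by
        rw [cnfSum, List.map_ofFn]
        rfl
      rw [he]
      exact key
    · by_contra hcon
      obtain ⟨rfl, h2⟩ : m = 0 ∧ (f 0).2 = 1 := by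
        have := (hpos 0).2
        exact ⟨by omega, by omega⟩
      apply hl.ne_single (f 0).1
      have : f 0 = ((f 0).1, 1) := Prod.ext rfl h2
      rw [List.ofFn_succ, List.ofFn_zero]
      exact congrArg (fun x => [x]) this
    · intro i j hij u v x hx y hy
      exact hlt i j hij x (Finset.mem_biUnion.2 ⟨v, Finset.mem_univ _, hx⟩) y
        (Finset.mem_biUnion.2 ⟨u, Finset.mem_univ _, hy⟩)

/-- The induction principle following the recursive definition of the Schreier families. -/
theorem schreier_induction {p : Ordinal.{0} → Prop} (zero : p 0) (succ : ∀ ζ, p ζ → p (ζ + 1))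
    (opow_succ : ∀ β : Ordinal.{0}, p (ω ^ β) → p (ω ^ (β + 1)))
    (opow_limit : ∀ l : Ordinal.{0}, Order.IsSuccLimit l → l < ω₁ →
      (∀ b < l, p (ω ^ b)) → p (ω ^ l))
    (cnf : ∀ l, IsLimitCNF l → (∀ x ∈ l, p (ω ^ x.1)) → p (cnfSum l))
    (ξ : Ordinal.{0}) (hξ : ξ < ω₁) : p ξ := by
  induction ξ using WellFoundedLT.induction with
  | _ ξ ih =>
  have pow_of_lt : ∀ {b b' : Ordinal.{0}}, b < b' → ω ^ b < ω ^ b' :=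
    fun h => (opow_lt_opow_iff_right one_lt_omega0).2 h
  rcases zero_or_succ_or_isSuccLimit ξ with rfl | ⟨ζ, rfl⟩ | h
  · exact zero
  · have : ζ < Order.succ ζ := Order.lt_succ ζ
    exact succ ζ (ih ζ this (this.trans hξ))
  · by_cases hpow : ∃ b : Ordinal.{0}, ξ = ω ^ b
    · obtain ⟨b, rfl⟩ := hpow
      rcases zero_or_succ_or_isSuccLimit b with rfl | ⟨β, rfl⟩ | hb
      · exact absurd h (by simpa using not_isSuccLimit_add_one 0)
      · have hlt := pow_of_lt (Order.lt_succ β)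
        exact opow_succ β (ih _ hlt (hlt.trans hξ))
      · refine opow_limit b hb ((right_le_opow b one_lt_omega0).trans_lt hξ) fun b' hb' => ?_
        exact ih _ (pow_of_lt hb') ((pow_of_lt hb').trans hξ)
    · push Not at hpow
      obtain ⟨l, hl, rfl⟩ := exists_isLimitCNF h hpow
      exact cnf l hl fun x hx => ih _ (hl.opow_lt hx) ((hl.opow_lt hx).trans hξ)

theorem Schreier.pos {lam : Ordinal.{0} → ℕ → Ordinal.{0}} {ξ : Ordinal.{0}} {s : Finset ℕ}
    (h : Schreier lam ξ s) : s ∈ finSub := by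
  induction h with
  | zero => simp [finSub]
  | succ ζ n s hn hns hs ih =>
    intro x hx
    rcases Finset.mem_insert.1 hx with rfl | hx
    · exact hn
    · exact ih x hx
  | opow_succ β n t ht hlt hmin ih =>
    intro x hx
    obtain ⟨i, -, hi⟩ := Finset.mem_biUnion.1 hx
    exact ih i x hi
  | opow_limit l hl n s hmin hs ih => exact ih
  | limit m a p ha ha0 hp hmp t ht hlt hlt' ih =>
    intro x hx
    obtain ⟨i, -, hi⟩ := Finset.mem_biUnion.1 hx
    obtain ⟨j, -, hj⟩ := Finset.mem_biUnion.1 hi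
    exact ih i j x hj

/-! ### Thinness -/

/-- A family is thin if no member is a proper initial segment of another one. -/
def IsThin (B : Set (Finset ℕ)) : Prop := ∀ s ∈ B, ∀ t ∈ B, IsInitialSegment t s → t = s

theorem isInitialSegment_union_left {s t : Finset ℕ} (h : BlockLT s t) :
    IsInitialSegment s (s ∪ t) := by
  refine ⟨Finset.subset_union_left, fun x hx y hy hyx => ?_⟩
  rcases Finset.mem_union.1 hy with hy | hy
  · exact hy
  · exact absurd (h x hx y hy) (by omega)

theorem IsInitialSegment.trans {s t u : Finset ℕ} (h : IsInitialSegment s t)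
    (h' : IsInitialSegment t u) : IsInitialSegment s u :=
  ⟨h.1.trans h'.1, fun x hx y hy hyx => h.2 x hx y (h'.2 x (h.1 hx) y hy hyx) hyx⟩

theorem IsInitialSegment.comparable {s t u : Finset ℕ} (h : IsInitialSegment s u)
    (h' : IsInitialSegment t u) : IsInitialSegment s t ∨ IsInitialSegment t s := by
  have aux : ∀ {s t : Finset ℕ}, IsInitialSegment s u → IsInitialSegment t u → s ⊆ t →
      IsInitialSegment s t := fun h h' hst =>
    ⟨hst, fun x hx y hy hyx => h.2 x hx y (h'.1 hy) hyx⟩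
  by_cases hst : s ⊆ t
  · exact Or.inl (aux h h' hst)
  · refine Or.inr (aux h' h ?_)
    obtain ⟨x, hx, hxt⟩ := Finset.not_subset.1 hst
    intro y hy
    rcases le_total y x with hyx | hxy
    · exact h.2 x hx y (h'.1 hy) hyx
    · exact absurd (h'.2 y hy x (h.1 hx) hxy) hxt

theorem IsThin.eq_of_isInitialSegment {B : Set (Finset ℕ)} (hB : IsThin B) {s t u : Finset ℕ}
    (hs : s ∈ B) (ht : t ∈ B) (h : IsInitialSegment s u) (h' : IsInitialSegment t u) : s = t := by
  rcases h.comparable h' with h | h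
  · exact hB t ht s hs h
  · exact (hB s hs t ht h).symm

/-- Thinness of `B` forces the first pieces of two comparable unions to agree; the comparison then
passes to the second pieces. -/
theorem IsThin.join {B C : Set (Finset ℕ)} (hB : IsThin B) (hC : IsThin C) :
    IsThin (join B C) := by
  rintro _ ⟨s, hs, t, ht, hst, rfl⟩ _ ⟨s', hs', t', ht', hst', rfl⟩ h
  obtain rfl : s' = s := hB.eq_of_isInitialSegment hs' hs
    ((isInitialSegment_union_left hst').trans h) (isInitialSegment_union_left hst)
  congr 1
  refine hC t ht t' ht' ⟨fun x hx => ?_, fun x hx y hy hyx => ?_⟩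
  · rcases Finset.mem_union.1 (h.1 (Finset.mem_union_right _ hx)) with hx' | hx'
    · exact absurd (hst' x hx' x hx) (lt_irrefl _)
    · exact hx'
  · rcases Finset.mem_union.1 (h.2 x (Finset.mem_union_right _ hx) y
      (Finset.mem_union_right _ hy) hyx) with hy' | hy'
    · exact absurd (hst y hy' y hy) (lt_irrefl _)
    · exact hy'

theorem isThin_joinList {Bs : List (Set (Finset ℕ))} (h : ∀ B ∈ Bs, IsThin B) :
    IsThin (joinList Bs) := by
  induction Bs with
  | nil =>
    rintro _ rfl _ rfl -
    rfl
  | cons B Bs ih => exact (h B (by simp)).join (ih fun C hC => h C (by simp [hC]))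

theorem isThin_singletons : IsThin singletons := by
  rintro _ ⟨n, -, rfl⟩ _ ⟨m, -, rfl⟩ h
  simpa using h.1

theorem IsInitialSegment.isLeast {s t : Finset ℕ} (h : IsInitialSegment t s) {n m : ℕ}
    (hn : IsLeast (↑s : Set ℕ) n) (hm : IsLeast (↑t : Set ℕ) m) : m = n :=
  le_antisymm (hm.2 (h.2 m hm.1 n hn.1 (hn.2 (h.1 hm.1)))) (hn.2 (h.1 hm.1))

/-- At powers of `ω`, comparable nonempty sets share their minimum, so both are governed by the same
smaller family. -/
theorem isThin_schreierFamily {lam : Ordinal.{0} → ℕ → Ordinal.{0}} (hlam : IsLimitChoice lam)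
    (ξ : Ordinal.{0}) (hξ : ξ < ω₁) : IsThin (schreierFamily lam ξ) := by
  refine schreier_induction (p := fun ξ => IsThin (schreierFamily lam ξ)) ?_ ?_ ?_ ?_ ?_ ξ hξ
  · rw [schreierFamily_zero]
    rintro _ rfl _ rfl -
    rfl
  · intro ζ ih
    rw [schreierFamily_add_one]
    exact isThin_singletons.join ih
  · intro β ih
    rw [schreierFamily_opow_add_one]
    rintro s ⟨n, hn, hs⟩ t ⟨m, hm, ht⟩ h
    obtain rfl := h.isLeast hn hm
    exact isThin_joinList (fun B hB => (List.eq_of_mem_replicate hB) ▸ ih) s hs t ht h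
  · intro l hl hl₁ ih
    rw [schreierFamily_opow_limit lam hl]
    rintro s ⟨n, hn, hs⟩ t ⟨m, hm, ht⟩ h
    obtain rfl := h.isLeast hn hm
    exact ih _ ((hlam l hl hl₁).2.1 _ (hs.pos _ hn.1)).2 s hs t ht h
  · intro l hl ih
    rw [schreierFamily_cnfSum lam hl]
    refine isThin_joinList fun B hB => ?_
    rw [cnfFamilies, List.mem_reverse, List.mem_map] at hB
    obtain ⟨x, hx, rfl⟩ := hB
    exact isThin_joinList fun C hC => (List.eq_of_mem_replicate hC) ▸ ih x hx

end BlockRamsey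

/-! ### Ranks of trees -/

namespace BlockRamsey

open Ordinal

/-- `HasRank T α s` says that `s` has rank at least `α` in the tree `T` ordered by
end-extension by single elements. -/
inductive HasRank (T : Set (Finset ℕ)) : Ordinal.{0} → Finset ℕ → Prop
  | mk (α : Ordinal.{0}) (s : Finset ℕ) (hs : s ∈ T) (f : ∀ β < α, ℕ)
      (hf : ∀ β hβ, ∀ x ∈ s, x < f β hβ) (h : ∀ β hβ, HasRank T β (insert (f β hβ) s)) :
      HasRank T α s

theorem hasRank_iff {T : Set (Finset ℕ)} {α : Ordinal.{0}} {s : Finset ℕ} :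
    HasRank T α s ↔ s ∈ T ∧ ∀ β < α, ∃ n, (∀ x ∈ s, x < n) ∧ HasRank T β (insert n s) := by
  constructor
  · rintro ⟨_, _, hs, f, hf, h⟩
    exact ⟨hs, fun β hβ => ⟨f β hβ, hf β hβ, h β hβ⟩⟩
  · rintro ⟨hs, h⟩
    choose f hf h using h
    exact ⟨α, s, hs, f, hf, h⟩

theorem HasRank.mem {T : Set (Finset ℕ)} {α : Ordinal.{0}} {s : Finset ℕ}
    (h : HasRank T α s) : s ∈ T := (hasRank_iff.1 h).1

theorem HasRank.mono {T : Set (Finset ℕ)} {α β : Ordinal.{0}} {s : Finset ℕ}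
    (h : HasRank T α s) (hβ : β ≤ α) : HasRank T β s := by
  rw [hasRank_iff] at h ⊢
  exact ⟨h.1, fun γ hγ => h.2 γ (hγ.trans_le hβ)⟩

/-- Rank may be tested on ordinals exceeding each `γ < α`; this is how limit ranks are reached. -/
theorem hasRank_of_forall_lt {T : Set (Finset ℕ)} {α : Ordinal.{0}} {s : Finset ℕ}
    (hs : s ∈ T) (h : ∀ γ < α, ∃ δ, γ < δ ∧ HasRank T δ s) : HasRank T α s :=
  hasRank_iff.2 ⟨hs, fun γ hγ => by
    obtain ⟨δ, hγδ, hδ⟩ := h γ hγ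
    exact (hasRank_iff.1 hδ).2 γ hγδ⟩

/-- A family is closed under deleting maxima. -/
def IsMaxClosed (T : Set (Finset ℕ)) : Prop :=
  ∀ (s : Finset ℕ) (n : ℕ), (∀ x ∈ s, x < n) → insert n s ∈ T → s ∈ T

theorem HasRank.of_insert {T : Set (Finset ℕ)} (hT : IsMaxClosed T) {α : Ordinal.{0}}
    {s : Finset ℕ} {n : ℕ} (hn : ∀ x ∈ s, x < n) (h : HasRank T α (insert n s)) :
    HasRank T (α + 1) s :=
  hasRank_iff.2 ⟨hT s n hn h.mem, fun _ hβ => ⟨n, hn, h.mono (Order.lt_add_one_iff.1 hβ)⟩⟩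

theorem HasRank.of_union {T : Set (Finset ℕ)} (hT : IsMaxClosed T) {α : Ordinal.{0}}
    {s u : Finset ℕ} (hsu : BlockLT s u) (h : HasRank T α (s ∪ u)) : HasRank T α s := by
  induction u using Finset.induction_on_max with
  | empty => simpa using h
  | insert m u hm ih =>
    refine ih (fun x hx y hy => hsu x hx y (Finset.mem_insert_of_mem hy)) ?_
    rw [Finset.union_insert] at h
    refine (h.of_insert hT fun x hx => ?_).mono le_self_add
    rcases Finset.mem_union.1 hx with hx | hx
    · exact hsu x hx m (Finset.mem_insert_self _ _)
    · exact hm x hx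

/-! ### The Schreier families raise rank -/

/-- Members of `B` inside `M` occur arbitrarily far out. -/
def IsUnboundedIn (M : Set ℕ) (B : Set (Finset ℕ)) : Prop :=
  ∀ N : ℕ, ∃ u ∈ B, (↑u : Set ℕ) ⊆ M ∧ ∀ x ∈ u, N < x

/-- Every element of `M` is the minimum of a member of `B` inside `M`. -/
def HasAllMins (M : Set ℕ) (B : Set (Finset ℕ)) : Prop :=
  ∀ n ∈ M, ∃ u ∈ B, (↑u : Set ℕ) ⊆ M ∧ IsLeast (↑u : Set ℕ) n

/-- If all extensions of `s` by members of `B` inside `M` have rank at least `η`, then `s` has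
rank at least `η + ξ`. -/
def RaisesRank (M : Set ℕ) (T B : Set (Finset ℕ)) (ξ : Ordinal.{0}) : Prop :=
  ∀ (s : Finset ℕ) (η : Ordinal.{0}),
    (∀ u ∈ B, (↑u : Set ℕ) ⊆ M → BlockLT s u → HasRank T η (s ∪ u)) → HasRank T (η + ξ) s

theorem exists_mem_gt {M : Set ℕ} (hM : M.Infinite) (N : ℕ) (s : Finset ℕ) :
    ∃ n ∈ M, N < n ∧ ∀ x ∈ s, x < n := by
  obtain ⟨n, hn, h⟩ := hM.exists_gt (max N (s.sup id))
  refine ⟨n, hn, (le_max_left _ _).trans_lt h, fun x hx => ?_⟩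
  exact (Finset.le_sup (f := id) hx).trans_lt ((le_max_right _ _).trans_lt h)

theorem HasAllMins.isUnboundedIn {M : Set ℕ} (hM : M.Infinite) {B : Set (Finset ℕ)}
    (h : HasAllMins M B) : IsUnboundedIn M B := by
  intro N
  obtain ⟨n, hn, hN⟩ := hM.exists_gt N
  obtain ⟨u, hu, huM, hun⟩ := h n hn
  exact ⟨u, hu, huM, fun x hx => hN.trans_le (hun.2 hx)⟩

theorem HasAllMins.join {M : Set ℕ} {B C : Set (Finset ℕ)} (hB : HasAllMins M B)
    (hC : IsUnboundedIn M C) : HasAllMins M (join B C) := by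
  intro n hn
  obtain ⟨u, hu, huM, hun⟩ := hB n hn
  obtain ⟨v, hv, hvM, huv⟩ := hC (u.sup id)
  have hlt : BlockLT u v := fun x hx y hy => (Finset.le_sup (f := id) hx).trans_lt (huv y hy)
  refine ⟨u ∪ v, ⟨u, hu, v, hv, hlt, rfl⟩, by simp [huM, hvM], ?_, ?_⟩
  · simpa using Or.inl hun.1
  · intro x hx
    rcases Finset.mem_union.1 (Finset.mem_coe.1 hx) with hx | hx
    · exact hun.2 hx
    · exact (hlt n hun.1 x hx).le

theorem isUnboundedIn_joinList {M : Set ℕ} (hM : M.Infinite) {Bs : List (Set (Finset ℕ))}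
    (h : ∀ B ∈ Bs, HasAllMins M B) : IsUnboundedIn M (joinList Bs) := by
  induction Bs with
  | nil => exact fun N => ⟨∅, rfl, by simp⟩
  | cons B Bs ih =>
    exact ((h B (by simp)).join (ih fun C hC => h C (by simp [hC]))).isUnboundedIn hM

theorem hasAllMins_joinList {M : Set ℕ} (hM : M.Infinite) {Bs : List (Set (Finset ℕ))}
    (h : ∀ B ∈ Bs, HasAllMins M B) (hne : Bs ≠ []) : HasAllMins M (joinList Bs) := by
  cases Bs with
  | nil => exact absurd rfl hne
  | cons B Bs =>
    exact (h B (by simp)).join (isUnboundedIn_joinList hM fun C hC => h C (by simp [hC]))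

theorem raisesRank_empty (M : Set ℕ) (T : Set (Finset ℕ)) : RaisesRank M T {∅} 0 := by
  intro s η h
  simpa using h ∅ rfl (by simp) (by simp [BlockLT])

/-- The later family `C` acts first, at the nodes `s ∪ u`, and `B` then raises the result at `s`.
Hence the order `ζ + ξ`, which matches the rule that blocks of smaller exponents come first. -/
theorem RaisesRank.join {M : Set ℕ} {T B C : Set (Finset ℕ)} {ξ ζ : Ordinal.{0}}
    (hB : RaisesRank M T B ξ) (hC : RaisesRank M T C ζ) : RaisesRank M T (join B C) (ζ + ξ) := by
  intro s η h
  rw [← add_assoc]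
  refine hB s _ fun u hu huM hsu => hC _ _ fun v hv hvM huv => ?_
  rw [Finset.union_assoc]
  refine h _ ⟨u, hu, v, hv, fun x hx => huv x (Finset.mem_union_right _ hx), rfl⟩
    (by simp [huM, hvM]) fun x hx y hy => ?_
  rcases Finset.mem_union.1 hy with hy | hy
  · exact hsu x hx y hy
  · exact huv x (Finset.mem_union_left _ hx) y hy

theorem raisesRank_joinList_replicate {M : Set ℕ} {T B : Set (Finset ℕ)} {ξ : Ordinal.{0}}
    (hB : RaisesRank M T B ξ) (k : ℕ) :
    RaisesRank M T (joinList (List.replicate k B)) (ξ * k) := by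
  induction k with
  | zero => simpa using raisesRank_empty M T
  | succ k ih =>
    rw [List.replicate_succ, joinList_cons, Nat.cast_succ, mul_add_one]
    exact hB.join ih

theorem join_joinList_subset (Bs : List (Set (Finset ℕ))) (B : Set (Finset ℕ)) :
    join (joinList Bs) B ⊆ joinList (Bs ++ [B]) := by
  induction Bs with
  | nil =>
    rintro _ ⟨_, rfl, v, hv, -, rfl⟩
    exact ⟨v, hv, ∅, rfl, by simp [BlockLT], by simp⟩
  | cons C Cs ih =>
    rintro _ ⟨_, ⟨a, ha, u, hu, hau, rfl⟩, v, hv, huv, rfl⟩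
    refine ⟨a, ha, u ∪ v, ih ⟨u, hu, v, hv, fun x hx => huv x (Finset.mem_union_right _ hx), rfl⟩,
      fun x hx y hy => ?_, Finset.union_assoc _ _ _⟩
    rcases Finset.mem_union.1 hy with hy | hy
    · exact hau x hx y hy
    · exact huv x (Finset.mem_union_left _ hx) y hy

theorem raisesRank_joinList_append_singleton {M : Set ℕ} {T B : Set (Finset ℕ)}
    {Bs : List (Set (Finset ℕ))} {ξ ζ : Ordinal.{0}}
    (hB : RaisesRank M T B ξ) (hBs : RaisesRank M T (joinList Bs) ζ) :
    RaisesRank M T (joinList (Bs ++ [B])) (ξ + ζ) := fun s η h =>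
  hBs.join hB s η fun u hu => h u (join_joinList_subset Bs B hu)

theorem raisesRank_singletons {M : Set ℕ} (hM : M.Infinite) (hpos : ∀ n ∈ M, 1 ≤ n)
    {T : Set (Finset ℕ)} (hT : IsMaxClosed T) : RaisesRank M T singletons 1 := by
  intro s η h
  obtain ⟨n, hn, -, hns⟩ := exists_mem_gt hM 0 s
  have := h {n} ⟨n, hpos n hn, rfl⟩ (by simpa using hn) (fun x hx y hy => by
    rw [Finset.mem_singleton.1 hy]
    exact hns x hx)
  rw [Finset.union_comm, ← Finset.insert_eq] at this
  exact this.of_insert hT hns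

theorem hasAllMins_singletons {M : Set ℕ} (hpos : ∀ n ∈ M, 1 ≤ n) : HasAllMins M singletons :=
  fun n hn => ⟨{n}, ⟨n, hpos n hn, rfl⟩, by simpa using hn, by simp⟩

/-- One block with minimum `k + 1` is fixed, the remaining `k` blocks are free and contribute `ξ *
k`, and dropping the fixed block does not lower the rank. -/
theorem hasRank_of_forall_isLeast {M : Set ℕ} {T B : Set (Finset ℕ)} (hT : IsMaxClosed T)
    {ξ η : Ordinal.{0}} {s : Finset ℕ} {k : ℕ} (hB : HasAllMins M B)
    (hBT : RaisesRank M T B ξ) (hk : k + 1 ∈ M) (hks : ∀ x ∈ s, x < k + 1)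
    (h : ∀ u ∈ joinList (List.replicate (k + 1) B), (↑u : Set ℕ) ⊆ M → BlockLT s u →
      IsLeast (↑u : Set ℕ) (k + 1) → HasRank T η (s ∪ u)) :
    HasRank T (η + ξ * k) s := by
  obtain ⟨u, hu, huM, hun⟩ := hB (k + 1) hk
  have hsu : BlockLT s u := fun x hx y hy => (hks x hx).trans_le (hun.2 hy)
  refine HasRank.of_union hT hsu (raisesRank_joinList_replicate hBT k _ _ fun v hv hvM huv => ?_)
  rw [Finset.union_assoc]
  refine h _ ⟨u, hu, v, hv, fun x hx => huv x (Finset.mem_union_right _ hx), rfl⟩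
    (by simp [huM, hvM]) (fun x hx y hy => ?_) ⟨by simpa using Or.inl hun.1, fun x hx => ?_⟩
  · rcases Finset.mem_union.1 hy with hy | hy
    · exact hsu x hx y hy
    · exact huv x (Finset.mem_union_left _ hx) y hy
  · rcases Finset.mem_union.1 (Finset.mem_coe.1 hx) with hx | hx
    · exact hun.2 hx
    · exact (huv _ (Finset.mem_union_right _ hun.1) x hx).le

theorem mem_of_isUnboundedIn {M : Set ℕ} {T B : Set (Finset ℕ)} (hT : IsMaxClosed T)
    {s : Finset ℕ} {η : Ordinal.{0}} (hB : IsUnboundedIn M B)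
    (h : ∀ u ∈ B, (↑u : Set ℕ) ⊆ M → BlockLT s u → HasRank T η (s ∪ u)) : s ∈ T := by
  obtain ⟨u, hu, huM, hsu⟩ := hB (s.sup id)
  have hlt : BlockLT s u := fun x hx y hy => (Finset.le_sup (f := id) hx).trans_lt (hsu y hy)
  exact ((h u hu huM hlt).of_union hT hlt).mem

/-- The three properties feed each other: fixing a first block needs all minima, and completing it
to a member needs later blocks arbitrarily far out. At powers of `ω` the minimum can be chosen as
large as desired, so the ranks obtained are cofinal. -/
theorem schreierFamily_large {lam : Ordinal.{0} → ℕ → Ordinal.{0}} (hlam : IsLimitChoice lam)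
    {M : Set ℕ} (hM : M.Infinite) (hpos : ∀ n ∈ M, 1 ≤ n) {T : Set (Finset ℕ)}
    (hT : IsMaxClosed T) (ξ : Ordinal.{0}) (hξ : ξ < ω₁) :
    IsUnboundedIn M (schreierFamily lam ξ) ∧ (0 < ξ → HasAllMins M (schreierFamily lam ξ)) ∧
      RaisesRank M T (schreierFamily lam ξ) ξ := by
  have of_mins : ∀ {B : Set (Finset ℕ)} {q r : Prop}, HasAllMins M B → r →
      IsUnboundedIn M B ∧ (q → HasAllMins M B) ∧ r :=
    fun h hr => ⟨h.isUnboundedIn hM, fun _ => h, hr⟩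
  have hopow : ∀ b : Ordinal.{0}, 0 < ω ^ b := fun b => opow_pos b omega0_pos
  refine schreier_induction (p := fun ξ => IsUnboundedIn M (schreierFamily lam ξ) ∧
    (0 < ξ → HasAllMins M (schreierFamily lam ξ)) ∧ RaisesRank M T (schreierFamily lam ξ) ξ)
    ?_ ?_ ?_ ?_ ?_ ξ hξ
  · rw [schreierFamily_zero]
    exact ⟨fun N => ⟨∅, rfl, by simp⟩, fun h => absurd h (lt_irrefl _), raisesRank_empty M T⟩
  · rintro ζ ⟨h1, -, h3⟩
    rw [schreierFamily_add_one]
    exact of_mins ((hasAllMins_singletons hpos).join h1)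
      ((raisesRank_singletons hM hpos hT).join h3)
  · rintro β ⟨-, h2, h3⟩
    have hmins := h2 (hopow β)
    have hall : HasAllMins M (schreierFamily lam (ω ^ (β + 1))) := by
      rw [schreierFamily_opow_add_one]
      intro n hn
      obtain ⟨u, hu, huM, hun⟩ := hasAllMins_joinList hM
        (Bs := List.replicate n (schreierFamily lam (ω ^ β)))
        (fun B hB => (List.eq_of_mem_replicate hB) ▸ hmins)
        (by have := hpos n hn; simpa using (by omega : n ≠ 0)) n hn
      exact ⟨u, ⟨n, hun, hu⟩, huM, hun⟩
    refine of_mins hall fun s η h => ?_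
    refine hasRank_of_forall_lt (mem_of_isUnboundedIn hT (hall.isUnboundedIn hM) h) ?_
    intro γ hγ
    obtain ⟨δ, hδ, hγδ⟩ := (lt_add_iff_of_isSuccLimit (isSuccLimit_omega0_opow (by simp))).1 hγ
    rw [opow_add_one, lt_mul_iff_of_isSuccLimit isSuccLimit_omega0] at hδ
    obtain ⟨c, hc, hδc⟩ := hδ
    obtain ⟨k, rfl⟩ := lt_omega0.1 hc
    -- A minimum `n = m + 1 > k` leaves `m ≥ k` free blocks, enough to pass `ω ^ β * k`.
    obtain ⟨n, hn, hkn, hns⟩ := exists_mem_gt hM k s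
    obtain ⟨m, rfl⟩ := Nat.exists_eq_succ_of_ne_zero (by omega : n ≠ 0)
    refine ⟨η + ω ^ β * m, hγδ.trans_le ?_, hasRank_of_forall_isLeast hT hmins h3 hn hns ?_⟩
    · gcongr
      refine hδc.le.trans ?_
      gcongr
      omega
    · intro u hu huM hsu hun
      refine h u ?_ huM hsu
      rw [schreierFamily_opow_add_one]
      exact ⟨_, hun, hu⟩
  · intro l hl hl₁ ih
    obtain ⟨hmono, hsucc, hlub⟩ := hlam l hl hl₁
    have hall : HasAllMins M (schreierFamily lam (ω ^ l)) := by
      rw [schreierFamily_opow_limit lam hl]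
      intro n hn
      obtain ⟨u, hu, huM, hun⟩ := (ih _ (hsucc n (hpos n hn)).2).2.1 (hopow _) n hn
      exact ⟨u, ⟨n, hun, hu⟩, huM, hun⟩
    refine of_mins hall fun s η h => ?_
    refine hasRank_of_forall_lt (mem_of_isUnboundedIn hT (hall.isUnboundedIn hM) h) ?_
    intro γ hγ
    obtain ⟨δ, hδ, hγδ⟩ :=
      (lt_add_iff_of_isSuccLimit (isSuccLimit_omega0_opow hl.bot_lt.ne')).1 hγ
    obtain ⟨c, hc, hδc⟩ := (lt_opow_of_isSuccLimit omega0_ne_zero hl).1 hδ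
    obtain ⟨_, ⟨n₀, hn₀, rfl⟩, hcn₀⟩ := (lt_isLUB_iff hlub).1 hc
    obtain ⟨n, hn, hkn, hns⟩ := exists_mem_gt hM (n₀ + 1) s
    obtain ⟨m, rfl⟩ := Nat.exists_eq_succ_of_ne_zero (by omega : n ≠ 0)
    -- Here it matters that the chosen sequence consists of successors: with minimum `m + 1` the set
    -- is a union of `m + 1` blocks from `A_{ω^b}`, and `m ≥ 1` of them are free.
    obtain ⟨⟨b, hb⟩, hbl⟩ := hsucc (m + 1) (by omega)
    have hcb : c ≤ b := by
      rw [← Order.lt_add_one_iff, ← hb]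
      exact hcn₀.trans (hmono hn₀ (by simp) (by omega))
    have hbl' : b < l := by
      rw [hb] at hbl
      exact (Order.lt_add_one_iff.2 le_rfl).trans hbl
    obtain ⟨-, h2, h3⟩ := ih b hbl'
    refine ⟨η + ω ^ b * m, hγδ.trans_le ?_,
      hasRank_of_forall_isLeast hT (h2 (hopow b)) h3 hn hns ?_⟩
    · gcongr
      refine hδc.le.trans ((opow_le_opow_right omega0_pos hcb).trans ?_)
      have : (1 : Ordinal) ≤ m := by
        exact_mod_cast (by omega : 1 ≤ m)
      simpa using mul_le_mul_right this (ω ^ b)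
    · intro u hu huM hsu hun
      refine h u ?_ huM hsu
      rw [schreierFamily_opow_limit lam hl]
      refine ⟨_, hun, ?_⟩
      rw [hb, schreierFamily_opow_add_one]
      exact ⟨_, hun, hu⟩
  · intro l hl ih
    rw [schreierFamily_cnfSum lam hl]
    have hmins : ∀ B ∈ cnfFamilies lam l, HasAllMins M B := by
      intro B hB
      rw [cnfFamilies, List.mem_reverse, List.mem_map] at hB
      obtain ⟨x, hx, rfl⟩ := hB
      refine hasAllMins_joinList hM (fun C hC =>
        (List.eq_of_mem_replicate hC) ▸ (ih x hx).2.1 (hopow _)) ?_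
      have := (hl.pos x hx).2
      simpa using (by omega : x.2 ≠ 0)
    refine of_mins (hasAllMins_joinList hM hmins (by simpa [cnfFamilies] using hl.ne_nil)) ?_
    generalize l = l at ih
    induction l with
    | nil => simpa [cnfFamilies, cnfSum] using raisesRank_empty M T
    | cons x l ihl =>
      have h1 : cnfSum (x :: l) = ω ^ x.1 * x.2 + cnfSum l := by simp [cnfSum]
      have h2 : cnfFamilies lam (x :: l) = cnfFamilies lam l ++
          [joinList (List.replicate x.2 (schreierFamily lam (ω ^ x.1)))] := by simp [cnfFamilies]
      rw [h1, h2]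
      exact raisesRank_joinList_append_singleton
        (raisesRank_joinList_replicate (ih x (by simp)).2.2 x.2)
        (ihl fun y hy => ih y (by simp [hy]))

end BlockRamsey

/-! ### Sum bases and block sums -/

namespace BlockRamsey

open Filter

theorem mem_allSums {L : Set ℕ} {w : List ℕ} :
    w ∈ allSums L ↔ ∃ S, IsBlockSeq L S ∧ w = sumTuple S := by
  simp only [allSums, finSumSet, Set.mem_iUnion]
  constructor
  · rintro ⟨k, -, S, hS, -, rfl⟩
    exact ⟨S, hS, rfl⟩
  · rintro ⟨S, hS, rfl⟩
    exact ⟨S.length, List.length_pos_iff.2 hS.1, S, hS, rfl, rfl⟩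

theorem ne_nil_of_mem_allSums {L : Set ℕ} {w : List ℕ} (hw : w ∈ allSums L) : w ≠ [] := by
  obtain ⟨S, hS, rfl⟩ := mem_allSums.1 hw
  simpa [sumTuple] using hS.1

theorem phiInv_mem_finSub (n : ℕ) : phiInv n ∈ finSub := by
  intro x hx
  obtain ⟨y, -, rfl⟩ := Finset.mem_image.1 hx
  omega

theorem phiInv_nonempty {n : ℕ} (hn : 1 ≤ n) : (phiInv n).Nonempty := by
  rw [Finset.nonempty_iff_ne_empty]
  intro h
  have := phi_phiInv n
  rw [h] at this
  simp [phi] at this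
  omega

/-- Distinct powers of two below a power occurring in `b` add up to less than that power. -/
theorem lt_of_blockLT_phiInv {a b : ℕ} (hb : 1 ≤ b) (h : BlockLT (phiInv a) (phiInv b)) :
    a < b := by
  obtain ⟨m, hm⟩ := phiInv_nonempty hb
  have hm1 := phiInv_mem_finSub b m hm
  have h1 : 2 ^ (m - 1) ≤ b := by
    conv_rhs => rw [← phi_phiInv b]
    exact Finset.single_le_sum (f := fun l => 2 ^ (l - 1)) (fun _ _ => Nat.zero_le _) hm
  refine lt_of_lt_of_le ?_ h1
  conv_lhs => rw [← phi_phiInv a]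
  have hinj : Set.InjOn (fun l => l - 1) (phiInv a) := by
    intro x hx y hy hxy
    have := phiInv_mem_finSub a x hx
    have := phiInv_mem_finSub a y hy
    simp only at hxy
    omega
  unfold phi
  rw [← Finset.sum_image (f := fun l => 2 ^ l) hinj]
  refine Nat.geomSum_lt le_rfl fun k hk => ?_
  obtain ⟨x, hx, rfl⟩ := Finset.mem_image.1 hk
  have := h x hx m hm
  have := phiInv_mem_finSub a x hx
  omega

theorem minElt_eq {s : Finset ℕ} {n : ℕ} (h : IsLeast (↑s : Set ℕ) n) : minElt s = n :=
  h.csInf_eq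

theorem isLeast_minElt {s : Finset ℕ} (h : s.Nonempty) : IsLeast (↑s : Set ℕ) (minElt s) :=
  ⟨Nat.sInf_mem (s := (↑s : Set ℕ)) (by simpa using h), fun _ hx => Nat.sInf_le hx⟩

theorem isLeast_c {n : ℕ} (hn : 1 ≤ n) : IsLeast (↑(phiInv n) : Set ℕ) (c n) :=
  isLeast_minElt (phiInv_nonempty hn)

theorem c_lt_c {a b : ℕ} (ha : 1 ≤ a) (hb : 1 ≤ b) (h : BlockLT (phiInv a) (phiInv b)) :
    c a < c b := h _ (isLeast_c ha).1 _ (isLeast_c hb).1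

/-- The digit sets of distinct elements are disjoint, so addition produces no carries. -/
theorem IsSumBase.phiInv_sum {L : Set ℕ} (hL : IsSumBase L) {s : Finset ℕ}
    (hs : (↑s : Set ℕ) ⊆ L) : phiInv (∑ l ∈ s, l) = s.biUnion phiInv := by
  have hdisj : (↑s : Set ℕ).PairwiseDisjoint phiInv := by
    intro a ha b hb hab
    rw [Function.onFun, Finset.disjoint_left]
    intro x hxa hxb
    rcases lt_or_gt_of_ne hab with h | h
    · exact lt_irrefl _ (hL.2.2 a (hs ha) b (hs hb) h x hxa x hxb)
    · exact lt_irrefl _ (hL.2.2 b (hs hb) a (hs ha) h x hxb x hxa)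
  have h1 : ∑ l ∈ s, l = phi (s.biUnion phiInv) := by
    rw [phi, Finset.sum_biUnion hdisj]
    exact Finset.sum_congr rfl fun l _ => (phi_phiInv l).symm
  rw [h1, phiInv_phi]
  intro x hx
  obtain ⟨l, -, hl⟩ := Finset.mem_biUnion.1 hx
  exact phiInv_mem_finSub l x hl

theorem IsSumBase.blockLT_sum {L : Set ℕ} (hL : IsSumBase L) {s t : Finset ℕ}
    (hs : (↑s : Set ℕ) ⊆ L) (ht : (↑t : Set ℕ) ⊆ L) (hst : BlockLT s t) :
    BlockLT (phiInv (∑ l ∈ s, l)) (phiInv (∑ l ∈ t, l)) := by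
  rw [hL.phiInv_sum hs, hL.phiInv_sum ht]
  intro x hx y hy
  obtain ⟨a, ha, hxa⟩ := Finset.mem_biUnion.1 hx
  obtain ⟨b, hb, hyb⟩ := Finset.mem_biUnion.1 hy
  exact hL.2.2 a (hs ha) b (ht hb) (hst a ha b hb) x hxa y hyb

theorem le_sum_of_mem {s : Finset ℕ} {x : ℕ} (hx : x ∈ s) : x ≤ ∑ l ∈ s, l :=
  Finset.single_le_sum (f := fun l => l) (fun _ _ => Nat.zero_le _) hx

theorem IsSumBase.one_le_sum {L : Set ℕ} (hL : IsSumBase L) {s : Finset ℕ}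
    (hs : (↑s : Set ℕ) ⊆ L) (hne : s.Nonempty) : 1 ≤ ∑ l ∈ s, l := by
  obtain ⟨x, hx⟩ := hne
  exact (hL.2.1 x (hs hx)).trans (le_sum_of_mem hx)

/-- Without carries, the lowest digit of a sum is that of its smallest term. Thus the condition
defining `ξ`-sums can be read off the tuple of sums. -/
theorem IsSumBase.c_sum {L : Set ℕ} (hL : IsSumBase L) {s : Finset ℕ}
    (hs : (↑s : Set ℕ) ⊆ L) (hne : s.Nonempty) : c (∑ l ∈ s, l) = c (minElt s) := by
  have hm := isLeast_minElt hne
  have hcm := isLeast_c (hL.2.1 _ (hs hm.1))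
  conv_lhs => rw [c, hL.phiInv_sum hs]
  refine minElt_eq ⟨?_, ?_⟩
  · exact Finset.mem_coe.2 (Finset.mem_biUnion.2 ⟨_, hm.1, hcm.1⟩)
  · intro x hx
    obtain ⟨l, hl, hx⟩ := Finset.mem_biUnion.1 (Finset.mem_coe.1 hx)
    rcases (hm.2 hl).eq_or_lt with h | h
    · rw [← h] at hx
      exact hcm.2 hx
    · exact (hL.2.2 _ (hs hm.1) l (hs hl) h _ hcm.1 x hx).le

theorem IsSumBase.pairwise_of_mem_allSums {L : Set ℕ} (hL : IsSumBase L) {w : List ℕ}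
    (hw : w ∈ allSums L) : w.Pairwise fun a b => BlockLT (phiInv a) (phiInv b) := by
  obtain ⟨S, ⟨-, hS, hp⟩, rfl⟩ := mem_allSums.1 hw
  rw [sumTuple, List.pairwise_map]
  exact hp.imp_of_mem fun hs ht => hL.blockLT_sum (hS _ hs).2 (hS _ ht).2

theorem IsSumBase.one_le_of_mem_allSums {L : Set ℕ} (hL : IsSumBase L) {w : List ℕ}
    (hw : w ∈ allSums L) : ∀ x ∈ w, 1 ≤ x := by
  obtain ⟨S, ⟨-, hS, -⟩, rfl⟩ := mem_allSums.1 hw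
  intro x hx
  obtain ⟨s, hs, rfl⟩ := List.mem_map.1 hx
  exact hL.one_le_sum (hS s hs).2 (hS s hs).1

theorem IsSumBase.pairwise_lt {L : Set ℕ} (hL : IsSumBase L) {w : List ℕ}
    (hw : w ∈ allSums L) : w.Pairwise (· < ·) :=
  (hL.pairwise_of_mem_allSums hw).imp_of_mem fun _ hb =>
    lt_of_blockLT_phiInv (hL.one_le_of_mem_allSums hw _ hb)

theorem IsSumBase.pairwise_c_lt {L : Set ℕ} (hL : IsSumBase L) {w : List ℕ}
    (hw : w ∈ allSums L) : (w.map c).Pairwise (· < ·) := by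
  rw [List.pairwise_map]
  exact (hL.pairwise_of_mem_allSums hw).imp_of_mem fun ha hb =>
    c_lt_c (hL.one_le_of_mem_allSums hw _ ha) (hL.one_le_of_mem_allSums hw _ hb)

theorem IsSumBase.sumSet_eq {L : Set ℕ} (hL : IsSumBase L)
    (lam : Ordinal.{0} → ℕ → Ordinal.{0}) (ξ : Ordinal.{0}) :
    sumSet lam ξ L = {w | w ∈ allSums L ∧ w.map c ∈ tuples (schreierFamily lam ξ)} := by
  have key : ∀ S, IsBlockSeq L S → (S.map fun s => c (minElt s)) = (sumTuple S).map c := by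
    intro S hS
    rw [sumTuple, List.map_map]
    exact List.map_congr_left fun s hs => (hL.c_sum (hS.2.1 s hs).2 (hS.2.1 s hs).1).symm
  ext w
  constructor
  · rintro ⟨S, hS, h, rfl⟩
    rw [key S hS] at h
    exact ⟨mem_allSums.2 ⟨S, hS, rfl⟩, h⟩
  · rintro ⟨hw, h⟩
    obtain ⟨S, hS, rfl⟩ := mem_allSums.1 hw
    rw [← key S hS] at h
    exact ⟨S, hS, h, rfl⟩

theorem mem_allSums_of_append_singleton {L : Set ℕ} {w : List ℕ} {x : ℕ}
    (h : w ++ [x] ∈ allSums L) (hw : w ≠ []) : w ∈ allSums L := by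
  obtain ⟨S, ⟨hne, hS, hp⟩, hwS⟩ := mem_allSums.1 h
  obtain ⟨S', s, rfl⟩ := (List.eq_nil_or_concat' S).resolve_left hne
  obtain ⟨rfl, -⟩ : w = sumTuple S' ∧ [x] = sumTuple [s] := by
    rw [sumTuple, List.map_append] at hwS
    exact List.append_inj' hwS rfl
  refine mem_allSums.2 ⟨S', ⟨?_, fun s hs => hS s (by simp [hs]), ?_⟩, rfl⟩
  · rintro rfl
    exact hw rfl
  · exact (List.pairwise_append.1 hp).1

theorem mem_allSums_of_prefix {L : Set ℕ} {v w : List ℕ} (hw : w ∈ allSums L)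
    (hv : v ≠ []) (h : v <+: w) : v ∈ allSums L := by
  obtain ⟨u, rfl⟩ := h
  induction u using List.reverseRecOn with
  | nil => simpa using hw
  | append_singleton u x ih =>
    rw [← List.append_assoc] at hw
    exact ih (mem_allSums_of_append_singleton hw (by simp [hv]))

theorem isSumBase_range_two_pow : IsSumBase (Set.range fun k => 2 ^ k) := by
  have hphi : ∀ k, phiInv (2 ^ k) = {k + 1} := by
    intro k
    simp [phiInv]
  refine ⟨Set.infinite_range_of_injective (Nat.pow_right_injective le_rfl), ?_, ?_⟩
  · rintro _ ⟨k, rfl⟩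
    exact Nat.one_le_two_pow
  · rintro _ ⟨k, rfl⟩ _ ⟨k', rfl⟩ h
    simp only [hphi]
    have := (Nat.pow_lt_pow_iff_right (le_refl 2)).1 h
    simpa [BlockLT] using this

/-! ### Idempotent ultrafilters on sums -/

/-- Sums of nonempty finite sets of elements of `L` larger than `N`. -/
def sumsAbove (L : Set ℕ) (N : ℕ) : Set ℕ :=
  {x | ∃ s : Finset ℕ, s.Nonempty ∧ (↑s : Set ℕ) ⊆ L ∧ (∀ l ∈ s, N < l) ∧ x = ∑ l ∈ s, l}

theorem singleton_mem_allSums {L : Set ℕ} {x : ℕ} (hx : x ∈ sumsAbove L 0) : [x] ∈ allSums L := by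
  obtain ⟨s, hne, hs, -, rfl⟩ := hx
  exact mem_allSums.2 ⟨[s], ⟨by simp, by simpa using ⟨hne, hs⟩, by simp⟩, rfl⟩

/-- The total `w.sum` bounds every element used in the blocks of `w`, whichever blocks represent it.
-/
theorem append_singleton_mem_allSums {L : Set ℕ} {w : List ℕ} {x : ℕ} (hw : w ∈ allSums L)
    (hx : x ∈ sumsAbove L w.sum) : w ++ [x] ∈ allSums L := by
  obtain ⟨S, ⟨hne, hS, hp⟩, rfl⟩ := mem_allSums.1 hw
  obtain ⟨s, hs, hsL, hgt, rfl⟩ := hx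
  refine mem_allSums.2 ⟨S ++ [s], ⟨by simp, ?_, ?_⟩, by simp [sumTuple]⟩
  · intro t ht
    rcases List.mem_append.1 ht with ht | ht
    · exact hS t ht
    · rw [List.mem_singleton.1 ht]
      exact ⟨hs, hsL⟩
  · refine List.pairwise_append.2 ⟨hp, by simp, fun t ht u hu x hx y hy => ?_⟩
    rw [List.mem_singleton.1 hu] at hy
    refine lt_of_le_of_lt ?_ (hgt y hy)
    exact (le_sum_of_mem hx).trans (List.le_sum_of_mem (List.mem_map.2 ⟨t, ht, rfl⟩))

/-- Ellis' theorem applies to the compact set of ultrafilters containing every `sumsAbove L N`. It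
is closed under addition: once the first summand is fixed, almost every second one uses only larger
elements of `L`. -/
theorem exists_idempotent_ultrafilter_sumsAbove {L : Set ℕ} (hL : L.Infinite) :
    ∃ U : Ultrafilter ℕ, (∀ N, ∀ᶠ x in U, x ∈ sumsAbove L N) ∧
      ∀ p : ℕ → Prop, (∀ᶠ x in U, p x) → ∀ᶠ x in U, ∀ᶠ y in U, p (x + y) := by
  let := Ultrafilter.addSemigroup (M := ℕ)
  let K : Set (Ultrafilter ℕ) := ⋂ N, {U | ∀ᶠ x in U, x ∈ sumsAbove L N}
  have h := exists_idempotent_in_compact_add_subsemigroup (M := Ultrafilter ℕ) ?_ K ?_ ?_ ?_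
  · obtain ⟨U, hU, hUU⟩ := h
    refine ⟨U, fun N => Set.mem_iInter.1 hU N, fun p hp => ?_⟩
    rw [← hUU] at hp
    exact hp
  · exact Ultrafilter.continuous_add_left
  · apply IsCompact.nonempty_iInter_of_sequence_nonempty_isCompact_isClosed
    · intro N U hU
      filter_upwards [hU]
      rintro _ ⟨s, h1, h2, h3, rfl⟩
      exact ⟨s, h1, h2, fun l hl => (Nat.lt_succ_self N).trans (h3 l hl), rfl⟩
    · intro N
      obtain ⟨n, hn, hN⟩ := hL.exists_gt N
      exact ⟨pure n, mem_pure.2 ⟨{n}, by simp, by simpa using hn, by simpa using hN, by simp⟩⟩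
    · exact (ultrafilter_isClosed_basic _).isCompact
    · exact fun N => ultrafilter_isClosed_basic _
  · exact IsClosed.isCompact (isClosed_iInter fun i => ultrafilter_isClosed_basic _)
  · intro U hU V hV
    refine Set.mem_iInter.2 fun N => ?_
    have hV' := Set.mem_iInter.1 hV
    change ∀ᶠ x in U, ∀ᶠ y in V, x + y ∈ sumsAbove L N
    filter_upwards [Set.mem_iInter.1 hU N]
    rintro _ ⟨s, h1, h2, h3, rfl⟩
    filter_upwards [hV' (max N (∑ l ∈ s, l))]
    rintro _ ⟨t, -, h2', h3', rfl⟩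
    refine ⟨s ∪ t, h1.mono Finset.subset_union_left, by simp [h2, h2'], ?_, ?_⟩
    · intro l hl
      rcases Finset.mem_union.1 hl with hl | hl
      · exact h3 l hl
      · exact (le_max_left _ _).trans_lt (h3' l hl)
    · rw [Finset.sum_union]
      rw [Finset.disjoint_left]
      intro l hl hl'
      exact absurd ((le_max_right _ _).trans_lt (h3' l hl')) (not_lt.2 (le_sum_of_mem hl))

end BlockRamsey

/-! ### Nash-Williams dichotomy -/

namespace BlockRamsey

open Filter

/-- `G` bars `w` in `A`: every way of successively extending `w` inside `A` meets `G`. -/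
inductive Bar (A G : Set (List ℕ)) : List ℕ → Prop
  | hit (w : List ℕ) (h : w ∈ G) : Bar A G w
  | step (w : List ℕ) (h : ∀ x, w ++ [x] ∈ A → Bar A G (w ++ [x])) : Bar A G w

/-- `G` bars `w` along a well-founded tree with `U`-large branching. -/
inductive UBar (U : Ultrafilter ℕ) (G : Set (List ℕ)) : List ℕ → Prop
  | hit (w : List ℕ) (h : w ∈ G) : UBar U G w
  | step (w : List ℕ) (A : Set ℕ) (hA : A ∈ U) (h : ∀ x ∈ A, UBar U G (w ++ [x])) : UBar U G w

/-- Every element of the list `l` lies in the set that `W` assigns to its predecessors. -/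
def Follows (W : List ℕ → Set ℕ) (l : List ℕ) : Prop := ∀ p x, p ++ [x] <+: l → x ∈ W p

theorem follows_nil (W : List ℕ → Set ℕ) : Follows W [] := by
  intro p x h
  simp at h

theorem follows_append_singleton {W : List ℕ → Set ℕ} {l : List ℕ} {x : ℕ} :
    Follows W (l ++ [x]) ↔ Follows W l ∧ x ∈ W l := by
  constructor
  · exact fun h => ⟨fun p y hp => h p y (hp.trans (List.prefix_append _ _)),
      h l x List.prefix_rfl⟩
  · rintro ⟨h, hx⟩ p y hp
    rcases List.prefix_concat_iff.1 hp with h' | h'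
    · obtain ⟨rfl, h2⟩ := List.append_inj' h' rfl
      obtain rfl : y = x := by simpa using h2
      exact hx
    · exact h p y h'

theorem Follows.mono {W W' : List ℕ → Set ℕ} (h : ∀ l, W l ⊆ W' l) {l : List ℕ}
    (hl : Follows W l) : Follows W' l := fun p x hp => h p (hl p x hp)

/-- The large sets of successors used in the derivation are collected into one assignment `W`; any
tree obeying `W` above `t` inherits the derivation as a genuine bar. -/
theorem UBar.exists_tree {U : Ultrafilter ℕ} {G : Set (List ℕ)} {t : List ℕ} (h : UBar U G t) :
    ∃ W : List ℕ → Set ℕ, (∀ l, W l ∈ U) ∧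
      ∀ A : Set (List ℕ), (∀ p x, p ++ [x] ∈ A → t <+: p → x ∈ W p) → Bar A G t := by
  induction h with
  | hit w h => exact ⟨fun _ => Set.univ, fun _ => univ_mem, fun A _ => Bar.hit w h⟩
  | step w A₀ hA₀ h ih =>
    choose! W hWU hW using ih
    classical
    -- For `p` properly extending `w`, the entry at position `w.length` names the child of `w` it
    -- passes through. The default `0` concerns only lists too short to extend `w` properly.
    refine ⟨fun p => if p = w then A₀ else
      if p.getD w.length 0 ∈ A₀ then W (p.getD w.length 0) p else Set.univ, ?_, ?_⟩
    · intro l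
      dsimp only
      split_ifs with h1 h2
      · exact hA₀
      · exact hWU _ h2 _
      · exact univ_mem
    · intro A hA
      refine Bar.step w fun x hx => ?_
      have hx₀ : x ∈ A₀ := by simpa using hA w x hx List.prefix_rfl
      refine hW x hx₀ A fun p y hp hwp => ?_
      have := hA p y hp ((List.prefix_append _ _).trans hwp)
      obtain ⟨q, rfl⟩ := hwp
      simpa [hx₀] using this

/-- For every set `G` of lists there is a tree with `U`-large branching all of whose subtrees
either avoid `G` or are barred by `G`. -/
theorem exists_tree_avoids_or_bar (U : Ultrafilter ℕ) (G : Set (List ℕ)) :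
    ∃ W : List ℕ → Set ℕ, (∀ l, W l ∈ U) ∧ ∀ A : Set (List ℕ), (∀ w ∈ A, Follows W w) →
      (∀ w ∈ A, w ∉ G) ∨ Bar A G [] := by
  by_cases h : UBar U G []
  · obtain ⟨W, hWU, hW⟩ := h.exists_tree
    exact ⟨W, hWU, fun A hA => Or.inr (hW A fun p x hp _ => hA _ hp p x List.prefix_rfl)⟩
  -- An unbarred node has `U`-many unbarred successors, otherwise `step` would bar it; following
  -- them from the root never meets `G`.
  · refine ⟨fun p => {x | ¬ UBar U G p → ¬ UBar U G (p ++ [x])}, fun l => ?_, fun A hA =>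
      Or.inl fun w hw hwG => ?_⟩
    · by_cases hl : UBar U G l
      · exact mem_of_superset univ_mem fun x _ h' => absurd hl h'
      · have : ∀ᶠ x in U, ¬ UBar U G (l ++ [x]) := by
          rw [Ultrafilter.eventually_not]
          exact fun hU => hl (UBar.step l _ hU fun x hx => hx)
        filter_upwards [this] with x hx _ using hx
    · have key : ∀ v, Follows (fun p => {x | ¬ UBar U G p → ¬ UBar U G (p ++ [x])}) v →
          ¬ UBar U G v := by
        intro v
        induction v using List.reverseRecOn with
        | nil => exact fun _ => h
        | append_singleton v x ih =>
          intro hv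
          rw [follows_append_singleton] at hv
          exact hv.2 (ih hv.1)
      exact key w (hA w hw) (UBar.hit w hwG)

/-- Adds `y` to the last element of a list. -/
def addLast (w : List ℕ) (y : ℕ) : List ℕ := w.dropLast ++ [w.getLastD 0 + y]

@[simp] theorem addLast_append_singleton (w : List ℕ) (x y : ℕ) :
    addLast (w ++ [x]) y = w ++ [x + y] := by simp [addLast]

/-- Each new `y` may be skipped, appended as a new block, or absorbed into the last block. Only
finitely many tuples exist at each stage, so one `y` can serve all of them. -/
theorem exists_generating_seq (V : List ℕ → Prop) (h0 : V [])
    (hstep : ∀ C : Finset (List ℕ), (∀ w ∈ C, V w) →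
      ∃ y, ∀ w ∈ C, V (w ++ [y]) ∧ (w ≠ [] → V (addLast w y))) :
    ∃ (d : ℕ → ℕ) (C : ℕ → Finset (List ℕ)), [] ∈ C 0 ∧
      (∀ n, ∀ w ∈ C n, w ∈ C (n + 1) ∧ w ++ [d n] ∈ C (n + 1) ∧
        (w ≠ [] → addLast w (d n) ∈ C (n + 1))) ∧ ∀ n, ∀ w ∈ C n, V w := by
  classical
  choose y hy using hstep
  let next : {C : Finset (List ℕ) // ∀ w ∈ C, V w} → {C : Finset (List ℕ) // ∀ w ∈ C, V w} :=
    fun C => ⟨C.1 ∪ C.1.image (· ++ [y C.1 C.2]) ∪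
      (C.1.filter (· ≠ [])).image (addLast · (y C.1 C.2)), by
      intro w hw
      simp only [Finset.mem_union, Finset.mem_image, Finset.mem_filter] at hw
      rcases hw with (hw | ⟨v, hv, rfl⟩) | ⟨v, ⟨hv, hv'⟩, rfl⟩
      · exact C.2 w hw
      · exact (hy C.1 C.2 v hv).1
      · exact (hy C.1 C.2 v hv).2 hv'⟩
  let st : ℕ → {C : Finset (List ℕ) // ∀ w ∈ C, V w} := fun n =>
    Nat.rec ⟨{[]}, by simpa using h0⟩ (fun _ C => next C) n
  refine ⟨fun n => y (st n).1 (st n).2, fun n => (st n).1, Finset.mem_singleton_self _,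
    fun n w hw => ?_, fun n => (st n).2⟩
  have hst : (st (n + 1)).1 = (st n).1 ∪ (st n).1.image (· ++ [y (st n).1 (st n).2]) ∪
      ((st n).1.filter (· ≠ [])).image (addLast · (y (st n).1 (st n).2)) := rfl
  simp only [hst, Finset.mem_union, Finset.mem_image, Finset.mem_filter]
  exact ⟨Or.inl (Or.inl hw), Or.inl (Or.inr ⟨w, hw, rfl⟩), fun h => Or.inr ⟨w, ⟨hw, h⟩, rfl⟩⟩

/-- The largest available element `d n` can lie only in the last block. It is absent, alone there,
or removable leaving a nonempty block, matching the three closure rules. -/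
theorem map_sum_mem_of_generating {d : ℕ → ℕ} (hd : StrictMono d) {C : ℕ → Finset (List ℕ)}
    (h0 : [] ∈ C 0)
    (hC : ∀ n, ∀ w ∈ C n, w ∈ C (n + 1) ∧ w ++ [d n] ∈ C (n + 1) ∧
        (w ≠ [] → addLast w (d n) ∈ C (n + 1)))
    (n : ℕ) (S : List (Finset ℕ)) (hp : S.Pairwise BlockLT)
    (hS : ∀ s ∈ S, s.Nonempty ∧ s ⊆ (Finset.range n).image d) : sumTuple S ∈ C n := by
  induction n generalizing S with
  | zero =>
    rcases S with _ | ⟨s, S⟩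
    · exact h0
    · obtain ⟨⟨x, hx⟩, hs⟩ := hS s (by simp)
      simpa using hs hx
  | succ n ih =>
    have himg : ∀ {x}, x ∈ (Finset.range (n + 1)).image d → x ≠ d n →
        x ∈ (Finset.range n).image d := by
      intro x hx hne
      obtain ⟨i, hi, rfl⟩ := Finset.mem_image.1 hx
      refine Finset.mem_image_of_mem d (Finset.mem_range.2 ?_)
      rcases (Nat.lt_succ_iff.1 (Finset.mem_range.1 hi)).lt_or_eq with h | rfl
      · exact h
      · exact absurd rfl hne
    have hle : ∀ {x}, x ∈ (Finset.range (n + 1)).image d → x ≤ d n := by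
      intro x hx
      obtain ⟨i, hi, rfl⟩ := Finset.mem_image.1 hx
      exact hd.monotone (Nat.lt_succ_iff.1 (Finset.mem_range.1 hi))
    rcases List.eq_nil_or_concat' S with rfl | ⟨S', s, rfl⟩
    · exact (hC n _ (ih [] (by simp) (by simp))).1
    · obtain ⟨hp', -, hps⟩ := List.pairwise_append.1 hp
      obtain ⟨⟨x₀, hx₀⟩, hs⟩ := hS s (by simp)
      have hS' : ∀ t ∈ S', t.Nonempty ∧ t ⊆ (Finset.range n).image d := by
        intro t ht
        obtain ⟨h1, h2⟩ := hS t (by simp [ht])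
        refine ⟨h1, fun x hx => himg (h2 hx) ?_⟩
        exact ((hps t ht s (by simp) x hx x₀ hx₀).trans_le (hle (hs hx₀))).ne
      by_cases hdn : d n ∈ s
      · rcases (s.erase (d n)).eq_empty_or_nonempty with he | hne
        · obtain rfl : s = {d n} := by
            rw [← Finset.insert_erase hdn, he]
            rfl
          have := (hC n _ (ih S' hp' hS')).2.1
          simpa [sumTuple] using this
        · have hmem := ih (S' ++ [s.erase (d n)])
            (List.pairwise_append.2 ⟨hp', by simp, fun t ht u hu x hx y hy => by
              rw [List.mem_singleton.1 hu] at hy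
              exact hps t ht s (by simp) x hx y (Finset.mem_of_mem_erase hy)⟩) (by
            intro t ht
            rcases List.mem_append.1 ht with ht | ht
            · exact hS' t ht
            · rw [List.mem_singleton.1 ht]
              exact ⟨hne, fun x hx => himg (hs (Finset.mem_of_mem_erase hx))
                (Finset.ne_of_mem_erase hx)⟩)
          have := (hC n _ hmem).2.2 (by simp [sumTuple])
          rw [sumTuple, List.map_append, List.map_singleton, addLast_append_singleton,
            Finset.sum_erase_add _ _ hdn] at this
          simpa [sumTuple] using this
      · refine (hC n _ (ih _ hp fun t ht => ?_)).1
        rcases List.mem_append.1 ht with ht | ht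
        · exact hS' t ht
        · rw [List.mem_singleton.1 ht]
          refine ⟨⟨x₀, hx₀⟩, fun x hx => himg (hs hx) ?_⟩
          rintro rfl
          exact hdn hx

theorem follows_allSums {L : Set ℕ} {w : List ℕ}
    (h : Follows (fun p => {x | p = [] ∨ p ∈ allSums L → p ++ [x] ∈ allSums L}) w) :
    w = [] ∨ w ∈ allSums L := by
  induction w using List.reverseRecOn with
  | nil => exact Or.inl rfl
  | append_singleton w x ih =>
    rw [follows_append_singleton] at h
    exact Or.inr (h.2 (ih h.1))

/-- A tree with branching large for a suitable idempotent ultrafilter contains all block sums of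
some sum base. -/
theorem IsSumBase.exists_follows {L : Set ℕ} (hL : IsSumBase L) :
    ∃ U : Ultrafilter ℕ, ∀ W : List ℕ → Set ℕ, (∀ l, W l ∈ U) →
      ∃ L', IsSumBase L' ∧ allSums L' ⊆ allSums L ∧ ∀ w ∈ allSums L', Follows W w := by
  obtain ⟨U, hU, hidem⟩ := exists_idempotent_ultrafilter_sumsAbove hL.1
  refine ⟨U, fun W₀ hW₀ => ?_⟩
  -- The second factor forces the new sums to be block sums of `L`.
  let W : List ℕ → Set ℕ := fun p =>
    W₀ p ∩ {x | p = [] ∨ p ∈ allSums L → p ++ [x] ∈ allSums L}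
  have hW : ∀ l, W l ∈ U := by
    intro l
    refine inter_mem (hW₀ l) ?_
    rcases eq_or_ne l [] with rfl | hl
    · filter_upwards [hU 0] with x hx _ using singleton_mem_allSums hx
    · filter_upwards [hU l.sum] with x hx h using
        append_singleton_mem_allSums (h.resolve_left hl) hx
  -- The Galvin–Glazer device: idempotence makes `star A` large whenever `A` is, and each point of
  -- `star A` stays in it after adding `U`-almost any `y`, so a last block can always grow.
  let star : Set ℕ → Set ℕ := fun A => {x | x ∈ A ∧ ∀ᶠ y in U, x + y ∈ A}
  have star_mem : ∀ {A : Set ℕ}, A ∈ U → ∀ᶠ x in U, x ∈ star A := by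
    intro A hA
    filter_upwards [hA, hidem (· ∈ A) hA] with x h1 h2 using ⟨h1, h2⟩
  have star_add : ∀ {A : Set ℕ} {x : ℕ}, x ∈ star A → ∀ᶠ y in U, x + y ∈ star A := by
    rintro A x ⟨-, hx⟩
    filter_upwards [hx, hidem (fun y => x + y ∈ A) hx] with y h1 h2
    exact ⟨h1, by simpa [add_assoc] using h2⟩
  obtain ⟨d, C, hC0, hC, hV⟩ := exists_generating_seq (Follows fun p => star (W p))
    (follows_nil _) (by
      intro C hC
      have : ∀ᶠ y in U, ∀ w ∈ C, Follows (fun p => star (W p)) (w ++ [y]) ∧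
          (w ≠ [] → Follows (fun p => star (W p)) (addLast w y)) := by
        rw [Filter.eventually_all_finset]
        intro w hw
        refine Filter.Eventually.and ?_ ?_
        · filter_upwards [star_mem (hW w)] with y hy
          exact follows_append_singleton.2 ⟨hC w hw, hy⟩
        · rcases List.eq_nil_or_concat' w with rfl | ⟨v, x, rfl⟩
          · simp
          · obtain ⟨h1, h2⟩ := follows_append_singleton.1 (hC _ hw)
            filter_upwards [star_add h2] with y hy _
            rw [addLast_append_singleton]
            exact follows_append_singleton.2 ⟨h1, hy⟩
      exact this.exists)
  have hVW : ∀ n, ∀ w ∈ C n, Follows W₀ w ∧ (w = [] ∨ w ∈ allSums L) := fun n w hw =>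
    ⟨(hV n w hw).mono fun l x hx => hx.1.1,
      follows_allSums ((hV n w hw).mono fun l x hx => hx.1.2)⟩
  have hmono : Monotone C := monotone_nat_of_le_succ fun n w hw => (hC n w hw).1
  have hone : ∀ i, [d i] ∈ C (i + 1) := fun i =>
    (hC i [] (hmono (Nat.zero_le i) hC0)).2.1
  have hsums : ∀ {n w}, w ∈ C n → w ≠ [] → w ∈ allSums L := fun hw hne =>
    (hVW _ _ hw).2.resolve_left hne
  have hpos : ∀ i, 1 ≤ d i := fun i =>
    hL.one_le_of_mem_allSums (hsums (hone i) (by simp)) _ (by simp)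
  have hblock : ∀ i j, i < j → BlockLT (phiInv (d i)) (phiInv (d j)) := by
    intro i j hij
    have h2 : [d i] ++ [d j] ∈ C (j + 1) := (hC j _ (hmono hij (hone i))).2.1
    simpa using hL.pairwise_of_mem_allSums (hsums h2 (by simp))
  have hd : StrictMono d := fun i j hij => lt_of_blockLT_phiInv (hpos j) (hblock i j hij)
  have hall : ∀ w ∈ allSums (Set.range d), ∃ n, w ∈ C n := by
    intro w hw
    obtain ⟨S, ⟨-, hS, hp⟩, rfl⟩ := mem_allSums.1 hw
    have hfin : ∀ x ∈ S.toFinset.biUnion id, ∃ i, d i = x := by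
      intro x hx
      obtain ⟨s, hs, hxs⟩ := Finset.mem_biUnion.1 hx
      exact (hS s (List.mem_toFinset.1 hs)).2 hxs
    choose! i hi using hfin
    refine ⟨((S.toFinset.biUnion id).sup i) + 1,
      map_sum_mem_of_generating hd hC0 hC _ S hp fun s hs => ⟨(hS s hs).1, fun x hx => ?_⟩⟩
    have hx' : x ∈ S.toFinset.biUnion id :=
      Finset.mem_biUnion.2 ⟨s, List.mem_toFinset.2 hs, hx⟩
    rw [← hi x hx']
    exact Finset.mem_image_of_mem d (Finset.mem_range.2 (Nat.lt_succ_iff.2 (Finset.le_sup hx')))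
  refine ⟨Set.range d, ⟨Set.infinite_range_of_injective hd.injective, ?_, ?_⟩, ?_, ?_⟩
  · rintro _ ⟨i, rfl⟩
    exact hpos i
  · rintro _ ⟨i, rfl⟩ _ ⟨j, rfl⟩ h
    exact hblock i j (hd.lt_iff_lt.1 h)
  · intro w hw
    obtain ⟨n, hn⟩ := hall w hw
    exact hsums hn (ne_nil_of_mem_allSums hw)
  · intro w hw
    obtain ⟨n, hn⟩ := hall w hw
    exact (hVW n w hn).1

/-- The Nash-Williams dichotomy for block sums. -/
theorem IsSumBase.avoids_or_bar {L : Set ℕ} (hL : IsSumBase L) (G : Set (List ℕ)) :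
    ∃ L', IsSumBase L' ∧ allSums L' ⊆ allSums L ∧
      ((∀ w ∈ allSums L', w ∉ G) ∨ Bar (allSums L') G []) := by
  obtain ⟨U, hU⟩ := hL.exists_follows
  obtain ⟨W, hWU, hW⟩ := exists_tree_avoids_or_bar U G
  obtain ⟨L', h1, h2, h3⟩ := hU W hWU
  exact ⟨L', h1, h2, hW _ h3⟩

end BlockRamsey

/-! ### Bars, ranks and the dichotomy for trees -/

namespace BlockRamsey

open Ordinal

theorem toFinset_injective_of_pairwise_lt {v w : List ℕ} (hv : v.Pairwise (· < ·))
    (hw : w.Pairwise (· < ·)) (h : v.toFinset = w.toFinset) : v = w :=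
  List.Pairwise.eq_of_mem_iff hv hw fun x => by
    rw [← List.mem_toFinset, h, List.mem_toFinset]

theorem pairwise_lt_sort (s : Finset ℕ) : (s.sort (· ≤ ·)).Pairwise (· < ·) :=
  (Finset.sortedLT_sort s).pairwise

theorem isInitialSegment_toFinset_of_prefix {v w : List ℕ} (hw : w.Pairwise (· < ·))
    (h : v <+: w) : IsInitialSegment v.toFinset w.toFinset := by
  obtain ⟨u, rfl⟩ := h
  rw [List.toFinset_append]
  refine isInitialSegment_union_left fun x hx y hy => ?_
  exact (List.pairwise_append.1 hw).2.2 x (List.mem_toFinset.1 hx) y (List.mem_toFinset.1 hy)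

theorem mem_allSums_of_pairwise_lt {L : Set ℕ} {w : List ℕ} (hne : w ≠ []) (hw : ∀ x ∈ w, x ∈ L)
    (hlt : w.Pairwise (· < ·)) : w ∈ allSums L := by
  refine mem_allSums.2 ⟨w.map fun x => {x}, ⟨by simpa using hne, ?_, ?_⟩, ?_⟩
  · intro s hs
    obtain ⟨x, hx, rfl⟩ := List.mem_map.1 hs
    simpa using hw x hx
  · rw [List.pairwise_map]
    exact hlt.imp fun h => by simpa [BlockLT] using h
  · simp [sumTuple, Function.comp_def]

/-- The members of `F` of the form of a block sum of `L`, together with `∅` if it lies in `F`. -/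
def sumTree (F : Set (Finset ℕ)) (L : Set ℕ) : Set (Finset ℕ) :=
  {s | s ∈ F ∧ ∃ w, (w = [] ∨ w ∈ allSums L) ∧ w.toFinset = s}

theorem IsSumBase.pairwise_lt_of_nil_or_mem {L : Set ℕ} (hL : IsSumBase L) {w : List ℕ}
    (hw : w = [] ∨ w ∈ allSums L) : w.Pairwise (· < ·) := by
  rcases hw with rfl | hw
  · exact List.Pairwise.nil
  · exact hL.pairwise_lt hw

/-- Nodes of the bar lie outside the tree. At a step, countably many bounds for the successors have
a supremum below `ω₁`, and one more than it is unattainable. -/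
theorem Bar.exists_not_hasRank {L : Set ℕ} (hL : IsSumBase L) {F : Set (Finset ℕ)} {w : List ℕ}
    (h : Bar (allSums L) {w | w.toFinset ∉ F} w) (hw : w = [] ∨ w ∈ allSums L) :
    ∃ α < ω₁, ¬ HasRank (sumTree F L) α w.toFinset := by
  induction h with
  | hit w h => exact ⟨0, omega_pos 1, fun hr => h hr.mem.1⟩
  | step w h ih =>
    have ih' : ∀ x, ∃ α < ω₁, w ++ [x] ∈ allSums L →
        ¬ HasRank (sumTree F L) α (w ++ [x]).toFinset := by
      intro x
      by_cases hx : w ++ [x] ∈ allSums L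
      · obtain ⟨α, h1, h2⟩ := ih x hx (Or.inr hx)
        exact ⟨α, h1, fun _ => h2⟩
      · exact ⟨0, omega_pos 1, fun h => absurd h hx⟩
    choose α hα hr using ih'
    have hsup : (⨆ x, α x) < ω₁ := iSup_lt_omega_one hα
    refine ⟨(⨆ x, α x) + 1, (Cardinal.isSuccLimit_omega 1).add_one_lt hsup, fun hrank => ?_⟩
    obtain ⟨n, hn, hrn⟩ := (hasRank_iff.1 hrank).2 _ (Order.lt_add_one_iff.2 le_rfl)
    obtain ⟨-, v, hv, hvn⟩ := hrn.mem
    have hvw : v = w ++ [n] := by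
      refine toFinset_injective_of_pairwise_lt (hL.pairwise_lt_of_nil_or_mem hv) ?_ ?_
      · refine List.pairwise_append.2 ⟨hL.pairwise_lt_of_nil_or_mem hw, by simp, ?_⟩
        intro x hx y hy
        rw [List.mem_singleton.1 hy]
        exact hn x (List.mem_toFinset.2 hx)
      · rw [hvn]
        ext x
        simp
    subst hvw
    refine hr n (hv.resolve_left (by simp)) ?_
    rw [hvn]
    exact hrn.mono (Ordinal.le_iSup α n)

/-- Descend the bar along `w`. A bar point comparable with `w` has a comparable image under `c`, so
thinness identifies the two. -/
theorem Bar.mem_of_isThin {L : Set ℕ} (hL : IsSumBase L) {F B : Set (Finset ℕ)} (hB : IsThin B)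
    {v : List ℕ} (h : Bar (allSums L) {w | w.toFinset ∈ F ∧ w.map c ∈ tuples B} v)
    (hv : v = [] ∨ v ∈ allSums L) {w : List ℕ} (hw : w ∈ allSums L) (hwB : w.map c ∈ tuples B)
    (hvw : v <+: w ∨ w <+: v) : w.toFinset ∈ F := by
  induction h with
  | hit v h =>
    have hmap : v.map c = w.map c := by
      refine toFinset_injective_of_pairwise_lt h.2.1 hwB.1 ?_
      rcases hvw with hp | hp
      · exact hB _ hwB.2 _ h.2.2 (isInitialSegment_toFinset_of_prefix hwB.1 (hp.map c))
      · exact (hB _ h.2.2 _ hwB.2 (isInitialSegment_toFinset_of_prefix h.2.1 (hp.map c))).symm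
    have hlen : v.length = w.length := by simpa using congrArg List.length hmap
    have : v = w := by
      rcases hvw with hp | hp
      · exact hp.eq_of_length hlen
      · exact (hp.eq_of_length hlen.symm).symm
    exact this ▸ h.1
  | step v h ih =>
    -- Beyond `w` the path is continued by any large element of the infinite set `L`, so it still
    -- meets the bar.
    have hext : w <+: v → w.toFinset ∈ F := by
      intro hp
      have hvA : v ∈ allSums L := hv.resolve_left fun h0 => by
        subst h0
        exact ne_nil_of_mem_allSums hw (List.prefix_nil.1 hp)
      obtain ⟨n, hn, hgt⟩ := hL.1.exists_gt v.sum
      have hmem := append_singleton_mem_allSums hvA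
        (x := n) ⟨{n}, by simp, by simpa using hn, by simpa using hgt, by simp⟩
      exact ih n hmem (Or.inr hmem) (Or.inr (hp.trans (List.prefix_append _ _)))
    rcases hvw with ⟨u, rfl⟩ | hp
    · rcases u with _ | ⟨x, u⟩
      · exact hext (by simp)
      · have hpre : v ++ [x] <+: v ++ x :: u := by simp
        have hmem := mem_allSums_of_prefix hw (by simp) hpre
        exact ih x hmem (Or.inr hmem) (Or.inl hpre)
    · exact hext hp

theorem IsTree.mem_of_isInitialSegment {F : Set (Finset ℕ)} (hF : IsTree F) {s t : Finset ℕ}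
    (hs : s ∈ F) (h : IsInitialSegment t s) : t ∈ F := by
  rw [← hF]
  exact Or.inl ⟨s, hs, h⟩

theorem IsTree.empty_mem {F : Set (Finset ℕ)} (hF : IsTree F) : ∅ ∈ F := by
  rw [← hF]
  exact Or.inr rfl

theorem IsSumBase.strictMonoOn_c {L : Set ℕ} (hL : IsSumBase L) : StrictMonoOn c L :=
  fun a ha b hb hab => c_lt_c (hL.2.1 a ha) (hL.2.1 b hb) (hL.2.2 a ha b hb hab)

/-- The increasing relabelling `e` preserves end-extensions, and finite subsets of `L` are block
sums with singleton blocks. -/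
theorem hasRank_image {F : Set (Finset ℕ)} {L M : Set ℕ} {e : ℕ → ℕ} (he : Set.MapsTo e M L)
    (hmono : StrictMonoOn e M) {α : Ordinal.{0}} {s : Finset ℕ}
    (h : HasRank {s | (↑s : Set ℕ) ⊆ M ∧ s.image e ∈ F} α s) :
    HasRank (sumTree F L) α (s.image e) := by
  induction h with
  | mk α s hs f hf h ih =>
    refine hasRank_iff.2 ⟨⟨hs.2, (s.image e).sort (· ≤ ·), ?_, Finset.sort_toFinset _ _⟩,
      fun β hβ => ⟨e (f β hβ), ?_, ?_⟩⟩
    · by_cases hne : (s.image e).sort (· ≤ ·) = []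
      · exact Or.inl hne
      · refine Or.inr (mem_allSums_of_pairwise_lt hne (fun x hx => ?_) (pairwise_lt_sort _))
        obtain ⟨y, hy, rfl⟩ := Finset.mem_image.1 ((Finset.mem_sort _).1 hx)
        exact he (hs.1 hy)
    · intro x hx
      obtain ⟨y, hy, rfl⟩ := Finset.mem_image.1 hx
      exact hmono (hs.1 hy) ((h β hβ).mem.1 (by simp)) (hf β hβ y hy)
    · rw [← Finset.image_insert]
      exact ih β hβ

theorem sumTree_mono (F : Set (Finset ℕ)) {L L' : Set ℕ} (h : allSums L' ⊆ allSums L) :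
    sumTree F L' ⊆ sumTree F L := fun _ ⟨hs, w, hw, hws⟩ => ⟨hs, w, hw.imp_right (@h w), hws⟩

theorem HasRank.subset {T T' : Set (Finset ℕ)} (hT : T ⊆ T') {α : Ordinal.{0}} {s : Finset ℕ}
    (h : HasRank T α s) : HasRank T' α s := by
  induction h with
  | mk α s hs f hf h ih => exact ⟨α, s, hT hs, f, hf, ih⟩

/-- If all `ξ`-sums of a sum base lie in a tree, then the tree has rank at least `ξ`. -/
theorem IsSumBase.hasRank_of_sums_mem {lam : Ordinal.{0} → ℕ → Ordinal.{0}}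
    (hlam : IsLimitChoice lam) {F : Set (Finset ℕ)} (hTree : IsTree F) {L : Set ℕ}
    (hL : IsSumBase L) {ξ : Ordinal.{0}} (hξ : ξ < ω₁)
    (h : ∀ w ∈ allSums L, w.map c ∈ tuples (schreierFamily lam ξ) → w.toFinset ∈ F) :
    HasRank (sumTree F L) ξ ∅ := by
  have hc := hL.strictMonoOn_c
  -- The family `A_ξ` constrains values of `c`, so rank is computed on `c '' L` and carried back to
  -- `L` by the inverse `e`.
  let M : Set ℕ := c '' L
  obtain ⟨e, he⟩ : ∃ e : ℕ → ℕ, ∀ m ∈ M, e m ∈ L ∧ c (e m) = m := by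
    choose! e he using fun m (hm : m ∈ M) => hm
    exact ⟨e, he⟩
  have hmono : StrictMonoOn e M := by
    intro a ha b hb hab
    rw [← hc.lt_iff_lt (he a ha).1 (he b hb).1, (he a ha).2, (he b hb).2]
    exact hab
  have hM : M.Infinite := hL.1.image hc.injOn
  have hMpos : ∀ n ∈ M, 1 ≤ n := by
    rintro _ ⟨l, hl, rfl⟩
    exact phiInv_mem_finSub l _ (isLeast_c (hL.2.1 l hl)).1
  have hT : IsMaxClosed {s | (↑s : Set ℕ) ⊆ M ∧ s.image e ∈ F} := by
    rintro s n hn ⟨h1, h2⟩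
    have hsM : (↑s : Set ℕ) ⊆ M := fun x hx => h1 (by simpa using Or.inr hx)
    refine ⟨hsM, hTree.mem_of_isInitialSegment h2 ?_⟩
    rw [Finset.insert_eq, Finset.union_comm, Finset.image_union]
    refine isInitialSegment_union_left fun x hx y hy => ?_
    obtain ⟨a, ha, rfl⟩ := Finset.mem_image.1 hx
    obtain rfl : y = e n := by simpa using hy
    exact hmono (hsM ha) (h1 (by simp)) (hn a ha)
  -- Starting from `η = 0`, only membership is needed: each nonempty `u` in `A_ξ` inside `M` is the
  -- `c`-image of the tuple enumerating `u.image e`.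
  have hrank := (schreierFamily_large hlam hM hMpos hT ξ hξ).2.2 ∅ 0 (by
    intro u hu huM _
    refine hasRank_iff.2 ⟨⟨by simpa using huM, ?_⟩, fun β hβ => absurd hβ not_lt_zero⟩
    rw [Finset.empty_union]
    rcases u.eq_empty_or_nonempty with rfl | hne
    · simpa using hTree.empty_mem
    have hsort : ((u.image e).sort (· ≤ ·)).toFinset = u.image e := Finset.sort_toFinset _ _
    have hwmem : (u.image e).sort (· ≤ ·) ∈ allSums L := by
      refine mem_allSums_of_pairwise_lt (fun h0 => ?_) (fun x hx => ?_) (pairwise_lt_sort _)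
      · rw [h0] at hsort
        exact (hne.image e).ne_empty hsort.symm
      · obtain ⟨y, hy, rfl⟩ := Finset.mem_image.1 ((Finset.mem_sort _).1 hx)
        exact (he y (huM hy)).1
    rw [← hsort]
    refine h _ hwmem ⟨hL.pairwise_c_lt hwmem, ?_⟩
    have : (((u.image e).sort (· ≤ ·)).map c).toFinset = u := by
      have hmap : (((u.image e).sort (· ≤ ·)).map c).toFinset = (u.image e).image c := by
        ext x
        simp
      rw [hmap, Finset.image_image]
      conv_rhs => rw [← Finset.image_id (s := u)]
      exact Finset.image_congr fun x hx => (he x (huM hx)).2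
    rw [this]
    exact hu)
  rw [zero_add] at hrank
  simpa using hasRank_image (fun m hm => (he m hm).1) hmono hrank

end BlockRamsey

theorem corollary3p6 (lam : Ordinal.{0} → ℕ → Ordinal.{0}) (hlam : BlockRamsey.IsLimitChoice lam)
    (F : Set (Finset ℕ)) (hF : F ⊆ BlockRamsey.finSub) (hTree : BlockRamsey.IsTree F) :
    (∃ L : Set ℕ, BlockRamsey.IsSumBase L ∧
      BlockRamsey.allSums L ⊆ BlockRamsey.tuples F) ∨
    (∃ ξ₀ : Ordinal.{0}, ξ₀ < Ordinal.omega 1 ∧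
      ∀ ξ : Ordinal.{0}, ξ₀ < ξ → ξ < Ordinal.omega 1 →
        ∃ L : Set ℕ, BlockRamsey.IsSumBase L ∧
          BlockRamsey.sumSet lam ξ L ⊆ BlockRamsey.tuples (BlockRamsey.finSub \ F)) := by
  obtain ⟨L, hL, -, h | h⟩ :=
    BlockRamsey.isSumBase_range_two_pow.avoids_or_bar {w | w.toFinset ∉ F}
  · exact Or.inl ⟨L, hL, fun w hw => ⟨hL.pairwise_lt hw, not_not.1 (h w hw)⟩⟩
  obtain ⟨ξ₀, hξ₀, hrank⟩ := h.exists_not_hasRank hL (Or.inl rfl)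
  refine Or.inr ⟨ξ₀, hξ₀, fun ξ hlt hξ => ?_⟩
  obtain ⟨L', hL', hsub, h' | h'⟩ := hL.avoids_or_bar
    {w | w.toFinset ∈ F ∧ w.map BlockRamsey.c ∈
      BlockRamsey.tuples (BlockRamsey.schreierFamily lam ξ)}
  · refine ⟨L', hL', ?_⟩
    rw [hL'.sumSet_eq]
    rintro w ⟨hw, hwc⟩
    exact ⟨hL'.pairwise_lt hw, fun x hx => hL'.one_le_of_mem_allSums hw x (List.mem_toFinset.1 hx),
      fun hwF => h' w hw ⟨hwF, hwc⟩⟩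
  · have hthin := BlockRamsey.isThin_schreierFamily hlam ξ hξ
    have := hL'.hasRank_of_sums_mem hlam hTree hξ fun w hw hwc =>
      h'.mem_of_isThin hL' hthin (Or.inl rfl) hw hwc (Or.inl (List.nil_prefix))
    -- The bound found for `L` also applies to `L'`, whose block sums are among those of `L`.
    exact absurd ((this.subset (BlockRamsey.sumTree_mono F hsub)).mono hlt.le) hrank
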